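/- Fix $\sigma>0$, $\beta>0$, $M>0$. In the distributed Gaussian sequence model with $n\ge 1$ and $m\ge1$ machines, machine $j\in\{1,\dots,m\}$ observes $\mathbf Y^j=(Y^j_i)_{i\ge1}$, where the $Y^j_i$ are independent and $Y^j_i\sim N(\theta_{0,i},\sigma^2m/n)$, with $\theta_0\in\ell^2$; write $\mathbf Y=(\mathbf Y^1,\dots,\mathbf Y^m)$ and $\mathrm P_{\theta_0},\mathrm E_{\theta_0}$ for the law of $\mathbf Y$ and its expectation. Let $$H^\beta(M)=\Big\{\theta\in\ell^2:\ \sup_{i\ge1} i^{1+2\beta}\theta_i^2\le M^2\Big\},\qquad \Pi(\cdot\,|\,\beta)=\bigotimes_{i=1}^\infty N(0,i^{-1-2\beta}),$$ the latter as a measure on $\ell^2$. Each machine computes the generalized posterior $$d\tilde\Pi^j(\theta\,|\,\mathbf Y^j)\propto p(\mathbf Y^j\,|\,\theta)^m\,d\Pi(\theta\,|\,\beta),\qquad p(\mathbf Y^j\,|\,\theta)\propto\prod_i e^{-\frac{n(Y_i^j-\theta_i)^2}{2\sigma^2m}}$$ (proportionality in $\theta$; the product is normalized by its value at $\theta=0$).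 The global posterior $\mathbf\Pi_{IV}(\cdot\,|\,\mathbf Y)$ is the 2-Wasserstein barycenter of the local ones, i.e. the minimizer of $\mu\mapsto\frac1m\sum_{j=1}^mW_2^2\big(\mu,\tilde\Pi^j(\cdot\,|\,\mathbf Y^j)\big)$ over all Borel probability measures $\mu$ on $\ell^2$ with finite second moment. Let $\hat\theta$ be the mean of $\mathbf\Pi_{IV}(\cdot\,|\,\mathbf Y)$, for $\gamma\in(0,1)$ let $r_\gamma\ge0$ be the radius with $\mathbf\Pi_{IV}(\theta:\|\theta-\hat\theta\|_2\le r_\gamma\,|\,\mathbf Y)=1-\gamma$, and for $L>0$ let $\hat C(L)=\{\theta\in\ell^2:\|\theta-\hat\theta\|_2\le Lr_\gamma\}$. These objects are well defined: for all $n,m\ge1$, all $\theta_0\in\ell^2$ and $\mathrm P_{\theta_0}$-almost all $\mathbf Y$, the local generalized posteriors are probability measures with finite second moment, their 2-Wasserstein barycenter exists and is unique, and for every $\gamma\in(0,1)$ the radius $r_\gamma$ exists and is unique. Moreover: 1. For every choice of the numbers of machines $m=m_n\ge1$ and every sequence $M_n\to\infty$, $$\sup_{\theta_0\in H^\beta(M)}\mathrm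 E_{\theta_0}\mathbf\Pi_{IV}\big(\theta:\ \|\theta-\theta_0\|_2>M_nn^{-\frac{\beta}{1+2\beta}}\,\big|\,\mathbf Y\big)\to0\qquad(n\to\infty).$$ 2. For every $\gamma\in(0,1)$ there is $L_0>0$ (depending only on $\sigma,\beta,M,\gamma$) such that for all $L\ge L_0$ and all $n,m\ge1$, $$\sup_{\theta_0\in H^\beta(M)}\mathrm P_{\theta_0}\big(\theta_0\notin\hat C(L)\big)\le\gamma.$$ -/

import Mathlib

open MeasureTheory ProbabilityTheory Filter Topology
open scoped ENNReal NNReal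

noncomputable section

/-! Sequences are indexed by `ℕ`; the index `i : ℕ` of the code is the index `i + 1 ∈ {1, 2, …}` of
the mathematics. -/

/-- The Hilbert space `ℓ²` of square-summable real sequences. -/
abbrev Ell2 : Type := lp (fun _ : ℕ => ℝ) 2

/-- `ℓ²` carries its Borel σ-algebra. -/
instance Ell2.instMeasurableSpace : MeasurableSpace Ell2 := borel Ell2

instance Ell2.instBorelSpace : BorelSpace Ell2 := ⟨rfl⟩

/-- The hyperrectangle `H^β(M) = {θ ∈ ℓ² : sup_i i^{1+2β} θ_i² ≤ M²}`. -/
def hyperRectangle (β M : ℝ) : Set Ell2 :=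
  {θ | ∀ i : ℕ, ((i : ℝ) + 1) ^ (1 + 2 * β) * (θ i) ^ 2 ≤ M ^ 2}

/-- The law of the distributed data `Y = (Y^j_i)`, `j` ranging over the `m` machines: the `Y^j_i` are
independent and `Y^j_i ∼ N(θ_i, σ² m / n)`. -/
def dataLaw (σ : ℝ) (n m : ℕ) (θ : Ell2) : Measure (Fin m → ℕ → ℝ) :=
  Measure.pi fun _ : Fin m =>
    Measure.infinitePi fun i : ℕ => gaussianReal (θ i) (Real.toNNReal (σ ^ 2 * m / n))

/-- The prior `⨂_i N(0, i^{-1-2α})`, as a measure on `ℓ²`: the product measure on `ℝ^ℕ`, restricted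
to `ℓ²`. -/
def gaussianPrior (α : ℝ) : Measure Ell2 :=
  (Measure.infinitePi fun i : ℕ =>
    gaussianReal 0 (Real.toNNReal (((i : ℝ) + 1) ^ (-1 - 2 * α)))).comap
      fun (θ : Ell2) (i : ℕ) => θ i

/-- The likelihood of one machine with data `y`, which is proportional (as a function of `θ`) to
`∏_i exp(- n (y_i - θ_i)² / (2 σ² m))`. The factor that does not depend on `θ` is fixed by taking the
likelihood ratio with respect to `θ = 0`, since the infinite product without a normalization vanishes
for almost all data. The upper limit over the number of factors is a limit for almost
all data `y` and almost all `θ` under the prior. -/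
def localLikelihood (σ : ℝ) (n m : ℕ) (y : ℕ → ℝ) (θ : Ell2) : ℝ≥0∞ :=
  limsup (fun N : ℕ => ENNReal.ofReal (∏ i ∈ Finset.range N,
    Real.exp (-(1 / 2) * (n * (y i - θ i) ^ 2 / (σ ^ 2 * m))) /
      Real.exp (-(1 / 2) * (n * (y i) ^ 2 / (σ ^ 2 * m))))) atTop

/-- Bayes' formula: the measure that is proportional to `f dπ`, normalized to total mass one. -/
def bayesPosterior {E : Type*} [MeasurableSpace E] (π : Measure E) (f : E → ℝ≥0∞) : Measure E :=
  (∫⁻ θ, f θ ∂π)⁻¹ • π.withDensity f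

/-- The generalized local posterior: the prior is `⨂_i N(0, i^{-1-2β})` and the local likelihood is
raised to the power `m`. -/
def localPosterior (β σ : ℝ) (n m : ℕ) (y : ℕ → ℝ) : Measure Ell2 :=
  bayesPosterior (gaussianPrior β) fun θ => localLikelihood σ n m y θ ^ m

section Wasserstein

variable {E : Type*} [NormedAddCommGroup E] [MeasurableSpace E]

/-- The squared 2-Wasserstein distance, an infimum over all couplings. -/
def wassersteinSq (μ ν : Measure E) : ℝ≥0∞ :=
  ⨅ (κ : Measure (E × E)) (_ : κ.map Prod.fst = μ) (_ : κ.map Prod.snd = ν),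
    ∫⁻ p, ‖p.1 - p.2‖ₑ ^ 2 ∂κ

/-- `μ` is a probability measure with finite second moment. -/
def HasFiniteSecondMoment (μ : Measure E) : Prop :=
  IsProbabilityMeasure μ ∧ ∫⁻ x, ‖x‖ₑ ^ 2 ∂μ < ∞

/-- The objective `m⁻¹ ∑_j W₂²(μ, μ_j)` of the barycenter problem. -/
def barycenterObjective {m : ℕ} (μs : Fin m → Measure E) (μ : Measure E) : ℝ≥0∞ :=
  (m : ℝ≥0∞)⁻¹ * ∑ j, wassersteinSq μ (μs j)

/-- `μ` is a 2-Wasserstein barycenter of `μ_1, …, μ_m`: it minimizes the objective among all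
probability measures with finite second moment. -/
def IsWassersteinBarycenter {m : ℕ} (μs : Fin m → Measure E) (μ : Measure E) : Prop :=
  HasFiniteSecondMoment μ ∧
    ∀ ν : Measure E, HasFiniteSecondMoment ν → barycenterObjective μs μ ≤ barycenterObjective μs ν

open Classical in
/-- The 2-Wasserstein barycenter (the zero measure if there is none). -/
def wassersteinBarycenter {m : ℕ} (μs : Fin m → Measure E) : Measure E :=
  if h : ∃ μ, IsWassersteinBarycenter μs μ then h.choose else 0

end Wasserstein

/-- The global posterior of the WASP method: the 2-Wasserstein barycenter of the generalized local
posteriors. -/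
def waspPosterior (β σ : ℝ) (n m : ℕ) (Y : Fin m → ℕ → ℝ) : Measure Ell2 :=
  wassersteinBarycenter fun j => localPosterior β σ n m (Y j)

/-- The mean of a measure on `ℓ²`. -/
def posteriorMean (μ : Measure Ell2) : Ell2 := ∫ θ, θ ∂μ

/-- `r` is the radius of a ball around the mean of `μ` which has `μ`-mass `1 - γ`. -/
def IsCredibleRadius (μ : Measure Ell2) (γ r : ℝ) : Prop :=
  0 ≤ r ∧ μ {θ | ‖θ - posteriorMean μ‖ ≤ r} = ENNReal.ofReal (1 - γ)

/-- The radius `r_γ`: the infimum picks the unique credible radius where there is exactly one, and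
the smallest possible value otherwise. -/
def credibleRadius (μ : Measure Ell2) (γ : ℝ) : ℝ := sInf {r | IsCredibleRadius μ γ r}

/-- The credible ball `Ĉ(L)` around the mean of `μ`, blown up by the factor `L`. -/
def credibleBall (μ : Measure Ell2) (γ L : ℝ) : Set Ell2 :=
  {θ | ‖θ - posteriorMean μ‖ ≤ L * credibleRadius μ γ}

end

/-! Raising a local likelihood to the power `m` undoes the inflation of the noise variance by `m`.
With the prior variances `l_i`, the precision `c = n / σ²`, the posterior variances `s_i = l_i / (1
+ c l_i)` and the shrinkage factors `a_i = c s_i`, conjugacy turns the local posterior of machine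
`j` into `⨂_i N(a_i Y_i^j, s_i)`. The covariance depends neither on `j` nor on the data, so all
local posteriors are translates of one centered Gaussian measure. Translating one argument by `v`
changes `W₂²` by an explicit quadratic function of `v` that involves only the means. Hence the
barycenter of translates is the translate by the average, and it is unique. The global posterior is
therefore `⨂_i N(a_i Ȳ_i, s_i)` with `Ȳ_i ∼ N(θ_i, σ² / n)`: the posterior based on all the data at
once, and `m` drops out of every bound.

Everything is then compared with the trace `T = ∑ s_i`. The identities `a_i σ² / n = s_i` and `(1 -
a_i) l_i = s_i` bound both variance and squared bias, so the risk of the mean is at most `(1 + M²)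
T` on the hyperrectangle (`lintegral_sqError_le`), and `T` is at most of order `n ^ (-2β / (1 +
2β))` (`tsum_postVar_le`). Markov's inequality gives contraction. A small ball estimate shows that
the squared credible radius is at least a constant times `T` (`credibleRadius_sq_gt`). Markov's
inequality for the squared error of the mean then gives coverage, since `T` cancels.

The analytic work lies in Bayes' formula in infinite dimensions (`smul_withDensity_seqGaussian`),
where the data are typically not in `ℓ²` and the log-likelihood ratio converges only almost surely,
in the translation formula `toReal_wassersteinSq_map_add`, and in the existence and uniqueness of
the credible radius. -/

noncomputable section

/-! ### The space `ℓ²` inside the space of all sequences -/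

namespace Ell2

/-- The inclusion of `ℓ²` into the space of all real sequences. -/
def toSeq (θ : Ell2) (i : ℕ) : ℝ := θ i

instance instSeparableSpace : TopologicalSpace.SeparableSpace Ell2 := by
  rw [← TopologicalSpace.isSeparable_univ_iff]
  have h : TopologicalSpace.IsSeparable
      (Set.range fun i : ℕ => (lp.single 2 i (1 : ℝ) : Ell2)) :=
    (Set.countable_range _).isSeparable
  refine (h.span (R := ℝ)).closure.mono fun f _ => ?_
  have hs := lp.hasSum_single (p := 2) (by simp) f
  refine mem_closure_of_tendsto hs (Eventually.of_forall fun s => ?_)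
  refine Submodule.sum_mem _ fun i _ => ?_
  have : lp.single 2 i (f i) = (f i) • (lp.single 2 i (1 : ℝ) : Ell2) := by
    rw [← lp.single_smul]; simp
  rw [this]
  exact Submodule.smul_mem _ _ (Submodule.subset_span ⟨i, rfl⟩)

instance instSecondCountableTopology : SecondCountableTopology Ell2 :=
  UniformSpace.secondCountable_of_separable Ell2

lemma continuous_apply (i : ℕ) : Continuous fun θ : Ell2 => θ i :=
  (lp.evalCLM ℝ (fun _ : ℕ => ℝ) 2 i).continuous

lemma measurable_toSeq : Measurable toSeq :=
  measurable_pi_iff.2 fun i => (continuous_apply i).measurable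

/-- Lusin–Souslin: `ℓ²` is Polish and the inclusion is injective and measurable. This makes `comap`
along the inclusion a genuine restriction of measures to `ℓ²`. -/
lemma measurableEmbedding_toSeq : MeasurableEmbedding toSeq :=
  measurable_toSeq.measurableEmbedding fun _ _ h => lp.ext h

lemma summable_sq (θ : Ell2) : Summable fun i => θ i ^ 2 := by
  simpa using (memℓp_gen_iff (p := 2) (by simp)).1 (lp.memℓp θ)

lemma mem_range_toSeq {x : ℕ → ℝ} (hx : Summable fun i => x i ^ 2) : x ∈ Set.range toSeq :=
  ⟨⟨x, memℓp_gen (by simpa using hx)⟩, rfl⟩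

lemma norm_sq_eq_tsum (θ : Ell2) : ‖θ‖ ^ 2 = ∑' i, θ i ^ 2 := by
  simpa using lp.norm_rpow_eq_tsum (p := 2) (by simp) θ

lemma enorm_sq (θ : Ell2) : ‖θ‖ₑ ^ 2 = ∑' i, ENNReal.ofReal (θ i ^ 2) := by
  rw [← ofReal_norm, ← ENNReal.ofReal_pow (norm_nonneg _), norm_sq_eq_tsum,
    ENNReal.ofReal_tsum_of_nonneg (fun _ => sq_nonneg _) (summable_sq θ)]

end Ell2

open Ell2

/-! ### Gaussian product measures -/

/-- The Gaussian product measure `⨂_i N(μ_i, s_i)` on the space of real sequences. -/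
def seqGaussian (μ : ℕ → ℝ) (s : ℕ → ℝ≥0) : Measure (ℕ → ℝ) :=
  Measure.infinitePi fun i => gaussianReal (μ i) (s i)

instance (μ : ℕ → ℝ) (s : ℕ → ℝ≥0) : IsProbabilityMeasure (seqGaussian μ s) := by
  unfold seqGaussian; infer_instance

/-- The Gaussian product measure `⨂_i N(μ_i, s_i)`, restricted to `ℓ²`. -/
def ell2Gaussian (μ : ℕ → ℝ) (s : ℕ → ℝ≥0) : Measure Ell2 :=
  (seqGaussian μ s).comap toSeq

lemma seqGaussian_map_eval (μ : ℕ → ℝ) (s : ℕ → ℝ≥0) (i : ℕ) :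
    (seqGaussian μ s).map (fun x => x i) = gaussianReal (μ i) (s i) :=
  Measure.infinitePi_map_eval _ i

lemma lintegral_ofReal_sq {Ω : Type*} [MeasurableSpace Ω] {P : Measure Ω} [IsProbabilityMeasure P]
    {X : Ω → ℝ} (hX : MemLp X 2 P) :
    ∫⁻ ω, ENNReal.ofReal (X ω ^ 2) ∂P = ENNReal.ofReal (Var[X; P] + (∫ ω, X ω ∂P) ^ 2) := by
  rw [← ofReal_integral_eq_lintegral_ofReal hX.integrable_sq (ae_of_all _ fun _ => sq_nonneg _),
    variance_eq_sub hX]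
  simp

lemma lintegral_sub_sq_gaussianReal (μ t : ℝ) (v : ℝ≥0) :
    ∫⁻ x, ENNReal.ofReal ((x - t) ^ 2) ∂gaussianReal μ v = ENNReal.ofReal ((μ - t) ^ 2) + v := by
  have hX : MemLp (fun x : ℝ => x) 2 (gaussianReal μ v) := memLp_id_gaussianReal' 2 (by simp)
  have hL : MemLp (fun x : ℝ => x - t) 2 (gaussianReal μ v) := hX.sub (memLp_const t)
  rw [lintegral_ofReal_sq hL, variance_sub_const hX.aestronglyMeasurable,
    variance_fun_id_gaussianReal, integral_sub (hX.integrable (by simp)) (integrable_const t),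
    integral_id_gaussianReal, add_comm, integral_const, ENNReal.ofReal_add (sq_nonneg _)
    v.coe_nonneg]
  simp

lemma lintegral_sub_sq_seqGaussian (μ : ℕ → ℝ) (s : ℕ → ℝ≥0) (i : ℕ) (t : ℝ) :
    ∫⁻ x, ENNReal.ofReal ((x i - t) ^ 2) ∂seqGaussian μ s =
      ENNReal.ofReal ((μ i - t) ^ 2) + s i := by
  rw [← lintegral_sub_sq_gaussianReal, ← seqGaussian_map_eval μ s i,
    lintegral_map (by fun_prop) (by fun_prop)]

/-- A random series with summable expected squares is almost surely summable. -/
lemma ae_summable_of_lintegral {Ω : Type*} [MeasurableSpace Ω] {P : Measure Ω} {f : ℕ → Ω → ℝ}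
    (hf : ∀ i, Measurable (f i)) (h0 : ∀ i ω, 0 ≤ f i ω)
    (h : ∑' i, ∫⁻ ω, ENNReal.ofReal (f i ω) ∂P ≠ ∞) : ∀ᵐ ω ∂P, Summable fun i => f i ω := by
  rw [← lintegral_tsum fun i => (hf i).ennreal_ofReal.aemeasurable] at h
  filter_upwards [ae_lt_top (Measurable.tsum fun i => (hf i).ennreal_ofReal) h] with ω hω
  have := ENNReal.summable_toReal hω.ne
  simpa [ENNReal.toReal_ofReal, h0] using this

/-- The expected weighted squares `w i * (μ i ^ 2 + s i)` are summable. Weight one shows that a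
Gaussian product measure lives on `ℓ²`; the prior variances as weights serve for the data. -/
lemma ae_summable_weighted_seqGaussian {μ w : ℕ → ℝ} {s : ℕ → ℝ≥0} (hw : ∀ i, 0 ≤ w i)
    (hμ : Summable fun i => w i * μ i ^ 2) (hs : Summable fun i => w i * s i) :
    ∀ᵐ x ∂seqGaussian μ s, Summable fun i => w i * x i ^ 2 := by
  refine ae_summable_of_lintegral (fun i => by fun_prop)
    (fun i x => mul_nonneg (hw i) (sq_nonneg _)) ?_
  have h : ∀ i, ∫⁻ x, ENNReal.ofReal (w i * x i ^ 2) ∂seqGaussian μ s =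
      ENNReal.ofReal (w i * μ i ^ 2 + w i * s i) := fun i => by
    have := lintegral_sub_sq_seqGaussian μ s i 0
    simp only [sub_zero] at this
    simp_rw [ENNReal.ofReal_mul (hw i)]
    rw [lintegral_const_mul _ (by fun_prop), this, ← mul_add, ENNReal.ofReal_mul (hw i),
      ENNReal.ofReal_add (sq_nonneg _) (s i).coe_nonneg]
    simp
  simp_rw [h]
  rw [← ENNReal.ofReal_tsum_of_nonneg _ (hμ.add hs)]
  · exact ENNReal.ofReal_ne_top
  · exact fun i => add_nonneg (mul_nonneg (hw i) (sq_nonneg _)) (mul_nonneg (hw i) (s i).2)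

lemma HasFiniteSecondMoment.memLp {E : Type*} [NormedAddCommGroup E] [SecondCountableTopology E]
    [MeasurableSpace E] [BorelSpace E] {μ : Measure E} (h : HasFiniteSecondMoment μ) :
    MemLp (fun x => x) 2 μ := by
  refine ⟨aestronglyMeasurable_id, ?_⟩
  rw [eLpNorm_lt_top_iff_lintegral_rpow_enorm_lt_top (by simp) (by simp)]
  simpa using h.2

section Ell2Gaussian

variable {μ : ℕ → ℝ} {s : ℕ → ℝ≥0}

lemma ell2Gaussian_map_toSeq (hμ : Summable fun i => μ i ^ 2) (hs : Summable s) :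
    (ell2Gaussian μ s).map toSeq = seqGaussian μ s := by
  rw [ell2Gaussian, measurableEmbedding_toSeq.map_comap]
  refine Measure.restrict_eq_self_of_ae_mem ?_
  have := ae_summable_weighted_seqGaussian (μ := μ) (s := s) (w := fun _ => 1) (by simp)
    (by simpa using hμ) (by simpa using NNReal.summable_coe.2 hs)
  filter_upwards [this] with x hx
  exact mem_range_toSeq (by simpa using hx)

/-- A measure on `ℓ²` is determined by its image on the space of sequences. -/
lemma eq_of_map_toSeq_eq {ν ρ : Measure Ell2} (h : ν.map toSeq = ρ.map toSeq) : ν = ρ := by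
  rw [← measurableEmbedding_toSeq.comap_map ν, h, measurableEmbedding_toSeq.comap_map]

lemma isProbabilityMeasure_ell2Gaussian (hμ : Summable fun i => μ i ^ 2) (hs : Summable s) :
    IsProbabilityMeasure (ell2Gaussian μ s) := by
  have h := ell2Gaussian_map_toSeq hμ hs
  constructor
  rw [← Set.preimage_univ (f := toSeq), ← Measure.map_apply measurable_toSeq .univ, h]
  simp

lemma lintegral_apply_ell2Gaussian (hμ : Summable fun i => μ i ^ 2) (hs : Summable s)
    {f : (ℕ → ℝ) → ℝ≥0∞} (hf : Measurable f) :
    ∫⁻ θ, f (toSeq θ) ∂ell2Gaussian μ s = ∫⁻ x, f x ∂seqGaussian μ s := by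
  rw [← ell2Gaussian_map_toSeq hμ hs, lintegral_map hf measurable_toSeq]

lemma lintegral_enorm_sub_sq_ell2Gaussian (hμ : Summable fun i => μ i ^ 2) (hs : Summable s)
    (t : Ell2) : ∫⁻ θ, ‖θ - t‖ₑ ^ 2 ∂ell2Gaussian μ s =
      ∑' i, (ENNReal.ofReal ((μ i - t i) ^ 2) + s i) := by
  simp_rw [enorm_sq]
  have := lintegral_apply_ell2Gaussian hμ hs
    (f := fun x => ∑' i, ENNReal.ofReal ((x i - t i) ^ 2)) (Measurable.tsum fun i => by fun_prop)
  refine this.trans ?_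
  rw [lintegral_tsum fun i => (by fun_prop : Measurable fun x : ℕ → ℝ => _).aemeasurable]
  simp_rw [lintegral_sub_sq_seqGaussian]

lemma hasFiniteSecondMoment_ell2Gaussian (hμ : Summable fun i => μ i ^ 2) (hs : Summable s) :
    HasFiniteSecondMoment (ell2Gaussian μ s) := by
  refine ⟨isProbabilityMeasure_ell2Gaussian hμ hs, ?_⟩
  have := lintegral_enorm_sub_sq_ell2Gaussian hμ hs 0
  simp only [sub_zero] at this
  rw [this, ENNReal.tsum_add]
  refine ENNReal.add_lt_top.2 ⟨?_, (ENNReal.tsum_coe_ne_top_iff_summable.2 hs).lt_top⟩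
  simp [← ENNReal.ofReal_tsum_of_nonneg (fun _ => sq_nonneg _) hμ]

lemma posteriorMean_ell2Gaussian (v : Ell2) (hs : Summable s) :
    posteriorMean (ell2Gaussian v s) = v := by
  have h2 := hasFiniteSecondMoment_ell2Gaussian (summable_sq v) hs
  have := h2.1
  have hi := h2.memLp.integrable (by simp)
  refine lp.ext (funext fun i => ?_)
  have := (lp.evalCLM ℝ (fun _ : ℕ => ℝ) 2 i).integral_comp_comm hi
  refine this.symm.trans ?_
  change ∫ θ, toSeq θ i ∂_ = _
  rw [← integral_map (φ := toSeq) (f := fun x => x i) measurable_toSeq.aemeasurable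
    (measurable_pi_apply i).aestronglyMeasurable, ell2Gaussian_map_toSeq (summable_sq v) hs,
    ← integral_map (φ := fun x : ℕ → ℝ => x i) (f := fun x => x)
      (measurable_pi_apply i).aemeasurable aestronglyMeasurable_id, seqGaussian_map_eval,
    integral_id_gaussianReal]

lemma ell2Gaussian_map_add (v : Ell2) (hs : Summable s) :
    (ell2Gaussian (fun _ => 0) s).map (fun θ => θ + v) = ell2Gaussian v s := by
  refine eq_of_map_toSeq_eq ?_
  rw [ell2Gaussian_map_toSeq (summable_sq v) hs,
    Measure.map_map measurable_toSeq (measurable_add_const v)]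
  have : toSeq ∘ (fun θ => θ + v) = (fun x i => x i + v i) ∘ toSeq := rfl
  rw [this, ← Measure.map_map (by fun_prop) measurable_toSeq,
    ell2Gaussian_map_toSeq (by simp) hs, seqGaussian,
    Measure.infinitePi_map_pi _ (f := fun i x => x + v i) fun i => by fun_prop]
  simp [gaussianReal_map_add_const, seqGaussian]

end Ell2Gaussian

/-! ### Conjugacy of the Gaussian model -/

/-- The variance of the posterior for the prior `N(0, l)` and the noise variance `c⁻¹`. -/
def tiltVar (c l : ℝ≥0) : ℝ≥0 := l / (1 + c * l)

lemma tiltVar_pos {c l : ℝ≥0} (hl : 0 < l) : 0 < tiltVar c l := by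
  unfold tiltVar; positivity

/-- Completing the square in the exponent, for a single coordinate. -/
lemma gaussianPDFReal_mul_exp {c l : ℝ≥0} (hl : 0 < l) (y x : ℝ) :
    gaussianPDFReal 0 l x * Real.exp (c * (y * x - x ^ 2 / 2)) =
      (√(tiltVar c l / l) * Real.exp (c ^ 2 * tiltVar c l * y ^ 2 / 2)) *
        gaussianPDFReal (c * tiltVar c l * y) (tiltVar c l) x := by
  have hs := tiltVar_pos (c := c) hl
  have hl' : (0 : ℝ) < l := hl
  have hs' : (0 : ℝ) < tiltVar c l := hs
  have hcl : (0 : ℝ) < 1 + c * l := by positivity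
  have hsl : (tiltVar c l : ℝ) = l / (1 + c * l) := by simp [tiltVar]
  have h1 : (√(2 * Real.pi * l))⁻¹ = √(tiltVar c l / l) * (√(2 * Real.pi * tiltVar c l))⁻¹ := by
    rw [Real.sqrt_div hs'.le, Real.sqrt_mul (by positivity) (l : ℝ),
      Real.sqrt_mul (by positivity) (tiltVar c l : ℝ)]
    have := (Real.sqrt_pos.2 hs').ne'
    field_simp
  have h2 : -(x - 0) ^ 2 / (2 * l) + c * (y * x - x ^ 2 / 2) =
      c ^ 2 * tiltVar c l * y ^ 2 / 2 +
        -(x - c * tiltVar c l * y) ^ 2 / (2 * tiltVar c l) := by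
    rw [hsl]
    field_simp
    ring
  simp only [gaussianPDFReal]
  rw [mul_assoc, ← Real.exp_add, h2, Real.exp_add, h1]
  ring

/-- Tilting a centered Gaussian by a Gaussian likelihood ratio gives a multiple of a Gaussian. -/
lemma exists_withDensity_gaussianReal {c l : ℝ≥0} (hl : 0 < l) (y : ℝ) :
    ∃ z : ℝ≥0∞, (gaussianReal 0 l).withDensity
      (fun x => ENNReal.ofReal (Real.exp (c * (y * x - x ^ 2 / 2)))) =
        z • gaussianReal (c * tiltVar c l * y) (tiltVar c l) := by
  refine ⟨ENNReal.ofReal (√(tiltVar c l / l) * Real.exp (c ^ 2 * tiltVar c l * y ^ 2 / 2)), ?_⟩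
  rw [gaussianReal_of_var_ne_zero _ hl.ne', gaussianReal_of_var_ne_zero _ (tiltVar_pos hl).ne',
    ← withDensity_mul _ (measurable_gaussianPDF _ _) (by fun_prop),
    ← withDensity_smul _ (measurable_gaussianPDF _ _)]
  congr 1
  ext x
  simp only [Pi.mul_apply, Pi.smul_apply, smul_eq_mul, gaussianPDF]
  rw [← ENNReal.ofReal_mul (gaussianPDFReal_nonneg _ _ _), gaussianPDFReal_mul_exp hl,
    ENNReal.ofReal_mul (by positivity)]

/-! ### Limits of integrals of `L²`-bounded sequences -/

/-- Convergence of integrals along an `L²`-bounded almost surely convergent sequence. -/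
lemma tendsto_lintegral_of_lintegral_sq_le {Ω : Type*} [MeasurableSpace Ω] {P : Measure Ω}
    [IsFiniteMeasure P] {f : ℕ → Ω → ℝ≥0∞} {g : Ω → ℝ≥0∞} {B : ℝ≥0∞} (hB : B ≠ ∞)
    (hf : ∀ n, Measurable (f n)) (hlim : ∀ᵐ x ∂P, Tendsto (fun n => f n x) atTop (𝓝 (g x)))
    (hbd : ∀ n, ∫⁻ x, f n x ^ 2 ∂P ≤ B) :
    Tendsto (fun n => ∫⁻ x, f n x ∂P) atTop (𝓝 (∫⁻ x, g x ∂P)) := by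
  refine tendsto_of_le_liminf_of_limsup_le ?_ ?_
  · calc ∫⁻ x, g x ∂P = ∫⁻ x, liminf (fun n => f n x) atTop ∂P :=
          lintegral_congr_ae (hlim.mono fun x hx => hx.liminf_eq.symm)
      _ ≤ _ := lintegral_liminf_le hf
  -- Truncation: `f ≤ min f (K + 1) + f² / (K + 1)`. The truncated part converges by dominated
  -- convergence and the remainder is at most `B / (K + 1)`, which vanishes as `K → ∞`.
  · have key : ∀ K : ℕ, limsup (fun n => ∫⁻ x, f n x ∂P) atTop ≤
        ∫⁻ x, g x ∂P + B / (K + 1 : ℕ) := fun K => by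
      have hle : ∀ n, ∫⁻ x, f n x ∂P ≤
          ∫⁻ x, min (f n x) (K + 1 : ℕ) ∂P + B / (K + 1 : ℕ) := fun n => by
        calc ∫⁻ x, f n x ∂P
            ≤ ∫⁻ x, (min (f n x) (K + 1 : ℕ) + f n x ^ 2 / (K + 1 : ℕ)) ∂P := by
              refine lintegral_mono fun x => ?_
              rcases le_total (f n x) ((K + 1 : ℕ) : ℝ≥0∞) with h | h
              · rw [min_eq_left h]; exact le_self_add
              · refine le_add_left ?_
                rw [ENNReal.le_div_iff_mul_le (by simp) (by simp), sq]
                gcongr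
          _ = ∫⁻ x, min (f n x) (K + 1 : ℕ) ∂P + (∫⁻ x, f n x ^ 2 ∂P) / (K + 1 : ℕ) := by
              rw [lintegral_add_left ((hf n).min measurable_const)]
              simp_rw [div_eq_mul_inv]
              rw [lintegral_mul_const _ ((hf n).pow_const 2)]
          _ ≤ _ := by gcongr; exact hbd n
      have hdct : Tendsto (fun n => ∫⁻ x, min (f n x) (K + 1 : ℕ) ∂P) atTop
          (𝓝 (∫⁻ x, min (g x) (K + 1 : ℕ) ∂P)) := by
        refine tendsto_lintegral_of_dominated_convergence (fun _ => ((K + 1 : ℕ) : ℝ≥0∞))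
          (fun n => (hf n).min measurable_const) (fun n => ae_of_all _ fun x => min_le_right _ _)
          (by simp [ENNReal.mul_eq_top]) ?_
        filter_upwards [hlim] with x hx using hx.min tendsto_const_nhds
      calc limsup (fun n => ∫⁻ x, f n x ∂P) atTop
          ≤ limsup (fun n => ∫⁻ x, min (f n x) (K + 1 : ℕ) ∂P + B / (K + 1 : ℕ)) atTop :=
            limsup_le_limsup (Eventually.of_forall hle)
        _ = ∫⁻ x, min (g x) (K + 1 : ℕ) ∂P + B / (K + 1 : ℕ) :=
            (hdct.add tendsto_const_nhds).limsup_eq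
        _ ≤ _ := by gcongr; exact min_le_left _ _
    have hT : Tendsto (fun K : ℕ => ∫⁻ x, g x ∂P + B / (K + 1 : ℕ)) atTop
        (𝓝 (∫⁻ x, g x ∂P + 0)) := by
      refine tendsto_const_nhds.add ?_
      have := (ENNReal.Tendsto.const_div (a := B) (tendsto_add_atTop_iff_nat 1 |>.2
        ENNReal.tendsto_nat_nhds_top) (Or.inr hB))
      simpa using this
    rw [add_zero] at hT
    exact ge_of_tendsto' hT key

/-! ### Random linear functionals under a centered Gaussian product measure -/

lemma lintegral_prod_seqGaussian (μ : ℕ → ℝ) (s : ℕ → ℝ≥0) (S : Finset ℕ) {f : ℕ → ℝ → ℝ≥0∞}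
    (hf : ∀ i, Measurable (f i)) :
    ∫⁻ x, ∏ i ∈ S, f i (x i) ∂seqGaussian μ s =
      ∏ i ∈ S, ∫⁻ x, f i x ∂gaussianReal (μ i) (s i) := by
  have h := lintegral_prod_eq_prod_lintegral_of_indepFun S (fun i (x : ℕ → ℝ) => f i (x i))
    (iIndepFun_infinitePi (P := fun i => gaussianReal (μ i) (s i)) hf)
    fun i => (hf i).comp (measurable_pi_apply i)
  refine h.trans (Finset.prod_congr rfl fun i _ => ?_)
  rw [← seqGaussian_map_eval μ s i, lintegral_map (hf i) (measurable_pi_apply i)]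
  rfl

section Centered

variable {l : ℕ → ℝ≥0} {y : ℕ → ℝ}

/-- A product of Gaussian moment generating functions. The values `t = ±1` bound the partial sums in
`L¹`; `t = 2c` bounds the likelihood ratios in `L²`. -/
lemma lintegral_exp_sum_seqGaussian_le (hy : Summable fun i => l i * y i ^ 2) (t : ℝ) (N : ℕ) :
    ∫⁻ x, ENNReal.ofReal (Real.exp (t * ∑ i ∈ Finset.range N, y i * x i))
      ∂seqGaussian (fun _ => 0) l ≤
        ENNReal.ofReal (Real.exp (t ^ 2 / 2 * ∑' i, l i * y i ^ 2)) := by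
  have h1 : ∀ x : ℕ → ℝ, ENNReal.ofReal (Real.exp (t * ∑ i ∈ Finset.range N, y i * x i)) =
      ∏ i ∈ Finset.range N, ENNReal.ofReal (Real.exp (t * y i * x i)) := fun x => by
    rw [← ENNReal.ofReal_prod_of_nonneg fun _ _ => (Real.exp_pos _).le, ← Real.exp_sum,
      Finset.mul_sum]
    simp_rw [mul_assoc]
  have h2 : ∀ i, ∫⁻ x, ENNReal.ofReal (Real.exp (t * y i * x)) ∂gaussianReal 0 (l i) =
      ENNReal.ofReal (Real.exp (t ^ 2 / 2 * (l i * y i ^ 2))) := fun i => by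
    rw [← ofReal_integral_eq_lintegral_ofReal (integrable_exp_mul_gaussianReal _)
      (ae_of_all _ fun _ => (Real.exp_pos _).le)]
    have := congrFun (mgf_fun_id_gaussianReal (μ := 0) (v := l i)) (t * y i)
    rw [mgf] at this
    rw [this]
    congr 2
    ring
  simp_rw [h1]
  rw [lintegral_prod_seqGaussian (fun _ => 0) l _
    (f := fun i x => ENNReal.ofReal (Real.exp (t * y i * x))) fun i => by fun_prop]
  simp_rw [h2]
  rw [← ENNReal.ofReal_prod_of_nonneg fun _ _ => (Real.exp_pos _).le, ← Real.exp_sum,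
    ← Finset.mul_sum]
  have h0 : ∀ i, 0 ≤ (l i : ℝ) * y i ^ 2 := fun i => by positivity
  have := hy.sum_le_tsum (Finset.range N) fun i _ => h0 i
  gcongr

/-- Partial sums of independent centered variables. They run up to and including `N`, since the
natural filtration at time `N` already knows the coordinate `N`. -/
lemma martingale_sum_seqGaussian (l : ℕ → ℝ≥0) (y : ℕ → ℝ) :
    ∃ ℱ : Filtration ℕ (inferInstance : MeasurableSpace (ℕ → ℝ)),
      Martingale (fun N (x : ℕ → ℝ) => ∑ i ∈ Finset.range (N + 1), y i * x i) ℱ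
        (seqGaussian (fun _ => 0) l) := by
  set P := seqGaussian (fun _ => 0) l with hP
  set u : ℕ → (ℕ → ℝ) → ℝ := fun i x => y i * x i with hu
  have hum : ∀ i, StronglyMeasurable (u i) := fun i => by
    apply Measurable.stronglyMeasurable; fun_prop
  have hint : ∀ i, Integrable (u i) P := fun i => by
    have h : Integrable (fun x : ℝ => y i * x) (P.map fun x => x i) := by
      rw [hP, seqGaussian_map_eval]
      exact ((memLp_id_gaussianReal' 1 (by simp)).integrable (by simp)).const_mul _
    exact h.comp_measurable (measurable_pi_apply i)
  have hmean : ∀ i, ∫ x, u i x ∂P = 0 := fun i => by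
    have : ∫ x, u i x ∂P = ∫ x, y i * x ∂(P.map fun x => x i) := by
      rw [integral_map (measurable_pi_apply i).aemeasurable (by fun_prop)]
    rw [this, hP, seqGaussian_map_eval, integral_const_mul, integral_id_gaussianReal, mul_zero]
  have hind : iIndepFun u P :=
    iIndepFun_infinitePi (X := fun i x => y i * x) fun i => by fun_prop
  refine ⟨Filtration.natural u hum, martingale_nat ?_ ?_ ?_⟩
  · intro N
    refine Finset.stronglyMeasurable_fun_sum _ fun i hi => ?_
    exact ((Filtration.stronglyAdapted_natural hum) i).mono
      ((Filtration.natural u hum).mono (by simpa [Nat.lt_succ_iff] using hi))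
  · exact fun N => integrable_finsetSum _ fun i _ => hint i
  · intro N
    have hadapt : StronglyMeasurable[Filtration.natural u hum N]
        (fun x => ∑ i ∈ Finset.range (N + 1), u i x) :=
      Finset.stronglyMeasurable_fun_sum _ fun i hi =>
        ((Filtration.stronglyAdapted_natural hum) i).mono
          ((Filtration.natural u hum).mono (by simpa [Nat.lt_succ_iff] using hi))
    have hsum : Integrable (fun x => ∑ i ∈ Finset.range (N + 1), u i x) P :=
      integrable_finsetSum _ fun i _ => hint i
    have h1 : (fun x => ∑ i ∈ Finset.range (N + 1 + 1), y i * x i) =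
        (fun x => ∑ i ∈ Finset.range (N + 1), u i x) + u (N + 1) := by
      ext x; simp [Finset.sum_range_succ _ (N + 1), hu]
    rw [h1]
    filter_upwards [condExp_add hsum (hint (N + 1)) (Filtration.natural u hum N),
      hind.condExp_natural_ae_eq_of_lt hum (Nat.lt_succ_self N)] with x hx1 hx2
    rw [hx1, Pi.add_apply, hx2, hmean, add_zero,
      condExp_of_stronglyMeasurable ((Filtration.natural u hum).le N) hadapt hsum]

/-- As `y` need not lie in `ℓ²`, the pairing of `y` and `x` is only an almost sure limit. It exists
by martingale convergence; the `L¹` bound comes from `|r| ≤ exp r + exp (-r)`. -/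
lemma ae_tendsto_sum_seqGaussian (hy : Summable fun i => l i * y i ^ 2) :
    ∀ᵐ x ∂seqGaussian (fun _ => 0) l,
      ∃ a, Tendsto (fun N => ∑ i ∈ Finset.range N, y i * x i) atTop (𝓝 a) := by
  obtain ⟨ℱ, hM⟩ := martingale_sum_seqGaussian l y
  set b : ℝ := Real.exp (1 / 2 * ∑' i, l i * y i ^ 2)
  have hbd : ∀ N, eLpNorm (fun x : ℕ → ℝ => ∑ i ∈ Finset.range (N + 1), y i * x i) 1
      (seqGaussian (fun _ => 0) l) ≤ ((2 * b).toNNReal : ℝ≥0) := fun N => by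
    have h1 := lintegral_exp_sum_seqGaussian_le hy 1 (N + 1)
    have h2 := lintegral_exp_sum_seqGaussian_le hy (-1) (N + 1)
    norm_num at h1 h2
    rw [eLpNorm_one_eq_lintegral_enorm]
    calc _ ≤ ∫⁻ x, (ENNReal.ofReal (Real.exp (∑ i ∈ Finset.range (N + 1), y i * x i)) +
            ENNReal.ofReal (Real.exp (-∑ i ∈ Finset.range (N + 1), y i * x i)))
            ∂seqGaussian (fun _ => 0) l := by
          refine lintegral_mono fun x => ?_
          rw [← ENNReal.ofReal_add (Real.exp_pos _).le (Real.exp_pos _).le,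
            ← ofReal_norm, Real.norm_eq_abs]
          refine ENNReal.ofReal_le_ofReal (abs_le.2 ⟨?_, ?_⟩) <;>
          · set r := ∑ i ∈ Finset.range (N + 1), y i * x i
            have := Real.add_one_le_exp r
            have := Real.add_one_le_exp (-r)
            have := Real.exp_pos r
            have := Real.exp_pos (-r)
            linarith
      _ ≤ ENNReal.ofReal b + ENNReal.ofReal b := by
          rw [lintegral_add_left (by fun_prop)]
          exact add_le_add (by simpa [b] using h1) (by simpa [b] using h2)
      _ = _ := by
          rw [← ENNReal.ofReal_add (Real.exp_pos _).le (Real.exp_pos _).le, ← two_mul]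
          rfl
  filter_upwards [hM.submartingale.exists_ae_tendsto_of_bdd hbd] with x ⟨a, ha⟩
  exact ⟨a, (tendsto_add_atTop_iff_nat 1).1 ha⟩

/-- Bayes' formula for the infinite Gaussian sequence model: tilting the prior by the limit of the
finite-dimensional likelihood ratios gives a Gaussian product measure. -/
theorem smul_withDensity_seqGaussian {c : ℝ≥0} (hl : ∀ i, 0 < l i)
    (hy : Summable fun i => l i * y i ^ 2) {H : (ℕ → ℝ) → ℝ≥0∞}
    (hlim : ∀ᵐ x ∂seqGaussian (fun _ => 0) l, Tendsto (fun N => ENNReal.ofReal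
      (Real.exp (c * ∑ i ∈ Finset.range N, (y i * x i - x i ^ 2 / 2)))) atTop (𝓝 (H x)))
    (hpos : ∀ᵐ x ∂seqGaussian (fun _ => 0) l, H x ≠ 0) (hH : Measurable H) :
    (∫⁻ x, H x ∂seqGaussian (fun _ => 0) l)⁻¹ • (seqGaussian (fun _ => 0) l).withDensity H =
      seqGaussian (fun i => c * tiltVar c (l i) * y i) fun i => tiltVar c (l i) := by
  classical
  set P := seqGaussian (fun _ => 0) l with hP
  choose z hz using fun i => exists_withDensity_gaussianReal (c := c) (hl i) (y i)
  set e : ℕ → ℝ → ℝ≥0∞ := fun i x => ENNReal.ofReal (Real.exp (c * (y i * x - x ^ 2 / 2)))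
  have he : ∀ i, Measurable (e i) := fun i => by fun_prop
  set h : ℕ → (ℕ → ℝ) → ℝ≥0∞ := fun N x => ENNReal.ofReal
      (Real.exp (c * ∑ i ∈ Finset.range N, (y i * x i - x i ^ 2 / 2)))
  have hh : ∀ N, Measurable (h N) := fun N => by fun_prop
  have hprod : ∀ N x, h N x = ∏ i ∈ Finset.range N, e i (x i) := fun N x => by
    rw [← ENNReal.ofReal_prod_of_nonneg fun _ _ => (Real.exp_pos _).le, ← Real.exp_sum,
      ← Finset.mul_sum]
  set B := ENNReal.ofReal (Real.exp ((2 * c : ℝ) ^ 2 / 2 * ∑' i, l i * y i ^ 2))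
  -- Dropping the terms `- x i ^ 2 / 2` leaves the exponential of a linear functional with `t = 2c`.
  have hbd : ∀ N, ∫⁻ x, h N x ^ 2 ∂P ≤ B := fun N => by
    refine le_trans (lintegral_mono fun x => ?_) (lintegral_exp_sum_seqGaussian_le hy (2 * c) N)
    rw [← ENNReal.ofReal_pow (Real.exp_pos _).le, ← Real.exp_nat_mul]
    refine ENNReal.ofReal_le_ofReal (Real.exp_le_exp.2 ?_)
    rw [Nat.cast_ofNat, mul_assoc]
    gcongr with i _
    nlinarith [sq_nonneg (x i)]
  have hZ : Tendsto (fun N => ∫⁻ x, h N x ∂P) atTop (𝓝 (∫⁻ x, H x ∂P)) :=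
    tendsto_lintegral_of_lintegral_sq_le ENNReal.ofReal_ne_top hh hlim hbd
  have hZtop : ∫⁻ x, H x ∂P ≠ ∞ := by
    refine ne_of_lt (lt_of_le_of_lt (le_of_tendsto' hZ fun N => ?_)
      (ENNReal.add_lt_top.2 ⟨ENNReal.one_lt_top, ENNReal.ofReal_lt_top (r := Real.exp
        ((2 * c : ℝ) ^ 2 / 2 * ∑' i, l i * y i ^ 2))⟩))
    calc ∫⁻ x, h N x ∂P ≤ ∫⁻ x, (1 + h N x ^ 2) ∂P := by
          refine lintegral_mono fun x => ?_
          rcases le_total (h N x) 1 with hx | hx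
          · exact hx.trans le_self_add
          · exact le_add_left (le_self_pow hx two_ne_zero)
      _ = 1 + ∫⁻ x, h N x ^ 2 ∂P := by rw [lintegral_add_left (by fun_prop)]; simp
      _ ≤ _ := by gcongr; exact hbd N
  have hZ0 : ∫⁻ x, H x ∂P ≠ 0 := by
    rw [Ne, lintegral_eq_zero_iff hH]
    intro h0
    have hF : ∀ᵐ x ∂P, False := by
      filter_upwards [hpos, h0] with x hx1 hx2 using hx1 hx2
    exact IsProbabilityMeasure.ne_zero P (ae_eq_bot.1 (eventually_false_iff_eq_bot.1 hF))
  have hone : ∀ i (t : Set ℝ), MeasurableSet t → ∫⁻ x, t.indicator (e i) x ∂gaussianReal 0 (l i) =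
      z i * gaussianReal (c * tiltVar c (l i) * y i) (tiltVar c (l i)) t := fun i t ht => by
    rw [lintegral_indicator ht, ← withDensity_apply _ ht, hz i]
    rfl
  have hZN : ∀ N, ∫⁻ x, h N x ∂P = ∏ i ∈ Finset.range N, z i := fun N => by
    simp_rw [hprod]
    rw [hP, lintegral_prod_seqGaussian _ _ _ he]
    refine Finset.prod_congr rfl fun i _ => ?_
    have := hone i Set.univ .univ
    simpa using this
  -- A product measure is determined by finite boxes. Once `N` exceeds all indices in `S`, the
  -- integral of `h N` over a box is its total integral times the claimed box probability; both
  -- sides pass to the limit in `N`.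
  refine Measure.eq_infinitePi _ fun S t ht => ?_
  have hbox : MeasurableSet ((S : Set ℕ).pi t) :=
    MeasurableSet.pi S.countable_toSet fun i _ => ht i
  have hlimS : Tendsto (fun N => ∫⁻ x in (S : Set ℕ).pi t, h N x ∂P) atTop
      (𝓝 (∫⁻ x in (S : Set ℕ).pi t, H x ∂P)) :=
    tendsto_lintegral_of_lintegral_sq_le ENNReal.ofReal_ne_top hh (ae_restrict_of_ae hlim)
      fun N => (setLIntegral_le_lintegral _ _).trans (hbd N)
  have hval : ∀ᶠ N in atTop, ∫⁻ x in (S : Set ℕ).pi t, h N x ∂P = (∫⁻ x, h N x ∂P) *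
      ∏ i ∈ S, gaussianReal (c * tiltVar c (l i) * y i) (tiltVar c (l i)) (t i) := by
    filter_upwards [eventually_ge_atTop (S.sup id + 1)] with N hN
    have hSN : S ⊆ Finset.range N := fun i hi =>
      Finset.mem_range.2 (lt_of_lt_of_le (Nat.lt_succ_of_le (Finset.le_sup (f := id) hi)) hN)
    set t' : ℕ → Set ℝ := fun i => if i ∈ S then t i else Set.univ with ht'
    have ht'm : ∀ i, MeasurableSet (t' i) := fun i => by
      by_cases hi : i ∈ S <;> simp [ht', hi, ht i]
    have hind : ∀ x, ((S : Set ℕ).pi t).indicator (h N) x =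
        ∏ i ∈ Finset.range N, (t' i).indicator (e i) (x i) := fun x => by
      by_cases hx : x ∈ (S : Set ℕ).pi t
      · rw [Set.indicator_of_mem hx, hprod]
        refine Finset.prod_congr rfl fun i _ => (Set.indicator_of_mem ?_ _).symm
        by_cases hi : i ∈ S
        · simpa [ht', hi] using hx i hi
        · simp [ht', hi]
      · rw [Set.indicator_of_notMem hx]
        simp only [Set.mem_pi, not_forall] at hx
        obtain ⟨i, hi, hxi⟩ := hx
        have h0 : (t' i).indicator (e i) (x i) = 0 :=
          Set.indicator_of_notMem (by simpa [ht', Finset.mem_coe.1 hi] using hxi) _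
        exact (Finset.prod_eq_zero (hSN hi) h0).symm
    rw [hZN, ← lintegral_indicator hbox]
    simp_rw [hind]
    rw [hP, lintegral_prod_seqGaussian _ _ _ fun i => (he i).indicator (ht'm i)]
    simp_rw [fun i => hone i (t' i) (ht'm i)]
    rw [Finset.prod_mul_distrib]
    congr 1
    rw [← Finset.prod_subset hSN (f := fun i =>
      gaussianReal (c * tiltVar c (l i) * y i) (tiltVar c (l i)) (t' i))]
    · exact Finset.prod_congr rfl fun i hi => by simp [ht', hi]
    · intro i _ hi
      simp [ht', hi]
  have hq : ∏ i ∈ S, gaussianReal (c * tiltVar c (l i) * y i) (tiltVar c (l i)) (t i) ≠ ∞ :=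
    ENNReal.prod_ne_top fun i _ => measure_ne_top _ _
  have := tendsto_nhds_unique (hlimS.congr' hval) (ENNReal.Tendsto.mul_const hZ (Or.inr hq))
  rw [Measure.smul_apply, withDensity_apply _ hbox, this, smul_eq_mul, ← mul_assoc,
    ENNReal.inv_mul_cancel hZ0 hZtop, one_mul]

end Centered

/-! ### The local posteriors -/

lemma mul_tiltVar_le_one (c l : ℝ≥0) : c * tiltVar c l ≤ 1 := by
  unfold tiltVar
  rw [← mul_div_assoc]
  exact div_le_one_of_le₀ le_add_self zero_le

lemma tiltVar_le (c l : ℝ≥0) : tiltVar c l ≤ l :=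
  div_le_self zero_le le_self_add

lemma summable_tiltVar {l : ℕ → ℝ≥0} (hl : Summable l) (c : ℝ≥0) :
    Summable fun i => tiltVar c (l i) :=
  NNReal.summable_of_le (fun i => tiltVar_le c (l i)) hl

lemma summable_tiltMean_sq {l : ℕ → ℝ≥0} {y : ℕ → ℝ} (hy : Summable fun i => l i * y i ^ 2)
    (c : ℝ≥0) : Summable fun i => (c * tiltVar c (l i) * y i) ^ 2 := by
  refine Summable.of_nonneg_of_le (fun _ => sq_nonneg _) (fun i => ?_) (hy.mul_left (c : ℝ))
  have h1 : (c : ℝ) * tiltVar c (l i) ≤ 1 := by exact_mod_cast mul_tiltVar_le_one c (l i)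
  have h2 : (tiltVar c (l i) : ℝ) ≤ l i := by exact_mod_cast tiltVar_le c (l i)
  calc (c * tiltVar c (l i) * y i) ^ 2
      = (c * tiltVar c (l i)) * (c * (tiltVar c (l i) * y i ^ 2)) := by ring
    _ ≤ 1 * (c * (l i * y i ^ 2)) := by gcongr
    _ = _ := one_mul _

lemma withDensity_comp_map_toSeq (π : Measure Ell2) {H : (ℕ → ℝ) → ℝ≥0∞} (hH : Measurable H) :
    (π.withDensity fun θ => H (toSeq θ)).map toSeq = (π.map toSeq).withDensity H := by
  ext A hA
  rw [Measure.map_apply measurable_toSeq hA, withDensity_apply _ (measurable_toSeq hA),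
    withDensity_apply _ hA, setLIntegral_map hA hH measurable_toSeq]

/-- The variances of the prior `⨂_i N(0, i^{-1-2β})`. -/
def priorVar (β : ℝ) (i : ℕ) : ℝ≥0 := Real.toNNReal (((i : ℝ) + 1) ^ (-1 - 2 * β))

lemma coe_priorVar (β : ℝ) (i : ℕ) : (priorVar β i : ℝ) = ((i : ℝ) + 1) ^ (-1 - 2 * β) :=
  Real.coe_toNNReal _ (by positivity)

lemma priorVar_pos (β : ℝ) (i : ℕ) : 0 < priorVar β i :=
  Real.toNNReal_pos.2 (by positivity)

lemma summable_priorVar {β : ℝ} (hβ : 0 < β) : Summable (priorVar β) := by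
  rw [← NNReal.summable_coe]
  simp_rw [coe_priorVar]
  have h := (summable_nat_add_iff 1).2 (Real.summable_nat_rpow (p := -1 - 2 * β)|>.2 (by linarith))
  simpa using h

/-- The precision `n / σ²` of the data that the tempered local likelihood stands for. -/
def precision (σ : ℝ) (n : ℕ) : ℝ≥0 := Real.toNNReal (n / σ ^ 2)

lemma coe_precision (σ : ℝ) (n : ℕ) : (precision σ n : ℝ) = n / σ ^ 2 :=
  Real.coe_toNNReal _ (by positivity)

/-- The variances of the posterior. -/
def postVar (β σ : ℝ) (n i : ℕ) : ℝ≥0 := tiltVar (precision σ n) (priorVar β i)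

lemma summable_postVar {β : ℝ} (hβ : 0 < β) (σ : ℝ) (n : ℕ) : Summable (postVar β σ n) :=
  summable_tiltVar (summable_priorVar hβ) _

/-- The posterior mean is the data, multiplied by these shrinkage factors. -/
def shrinkage (β σ : ℝ) (n i : ℕ) : ℝ := precision σ n * postVar β σ n i

lemma summable_shrinkage_mul_sq {β : ℝ} {y : ℕ → ℝ}
    (hy : Summable fun i => priorVar β i * y i ^ 2) (σ : ℝ) (n : ℕ) :
    Summable fun i => (shrinkage β σ n i * y i) ^ 2 :=
  summable_tiltMean_sq hy _

/-- The local generalized posterior is a Gaussian product measure. -/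
theorem localPosterior_eq {β σ : ℝ} (hβ : 0 < β) (hσ : 0 < σ) {n m : ℕ} (hm : 1 ≤ m) {y : ℕ → ℝ}
    (hy : Summable fun i => priorVar β i * y i ^ 2) :
    localPosterior β σ n m y =
      ell2Gaussian (fun i => shrinkage β σ n i * y i) (postVar β σ n) := by
  set P := seqGaussian (fun _ => 0) (priorVar β) with hP
  have hm' : (m : ℝ) ≠ 0 := by positivity
  set F : (ℕ → ℝ) → ℝ≥0∞ := fun x => limsup (fun N : ℕ => ENNReal.ofReal (∏ i ∈ Finset.range N,
    Real.exp (-(1 / 2) * (n * (y i - x i) ^ 2 / (σ ^ 2 * m))) /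
      Real.exp (-(1 / 2) * (n * (y i) ^ 2 / (σ ^ 2 * m))))) atTop with hF
  have hFm : Measurable F := by
    refine Measurable.limsup fun N => Measurable.ennreal_ofReal ?_
    exact Finset.measurable_fun_prod _ fun i _ => by fun_prop
  have hterm : ∀ (N : ℕ) (x : ℕ → ℝ), ∏ i ∈ Finset.range N,
      Real.exp (-(1 / 2) * (n * (y i - x i) ^ 2 / (σ ^ 2 * m))) /
        Real.exp (-(1 / 2) * (n * (y i) ^ 2 / (σ ^ 2 * m))) =
      Real.exp (precision σ n / m * ∑ i ∈ Finset.range N, (y i * x i - x i ^ 2 / 2)) := by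
    intro N x
    rw [Finset.mul_sum, Real.exp_sum]
    refine Finset.prod_congr rfl fun i _ => ?_
    rw [← Real.exp_sub, coe_precision]
    congr 1
    field_simp
    ring
  have hconv : ∀ᵐ x ∂P, ∃ a,
      Tendsto (fun N => ∑ i ∈ Finset.range N, (y i * x i - x i ^ 2 / 2)) atTop (𝓝 a) := by
    have h2 := ae_summable_weighted_seqGaussian (μ := fun _ => 0) (s := priorVar β)
      (w := fun _ => 1) (by simp) (by simp)
      (by simpa using NNReal.summable_coe.2 (summable_priorVar hβ))
    filter_upwards [ae_tendsto_sum_seqGaussian hy, h2] with x ⟨a, ha⟩ hx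
    simp only [one_mul] at hx
    refine ⟨_, (ha.sub (hx.hasSum.tendsto_sum_nat.div_const 2)).congr fun N => ?_⟩
    rw [Finset.sum_sub_distrib, Finset.sum_div]
  -- The power `m` cancels the factor `1 / m` in the precision of one machine.
  have hval : ∀ (x : ℕ → ℝ) (a : ℝ),
      Tendsto (fun N => ∑ i ∈ Finset.range N, (y i * x i - x i ^ 2 / 2)) atTop (𝓝 a) →
      F x ^ m = ENNReal.ofReal (Real.exp (precision σ n * a)) := by
    intro x a ha
    have h1 : Tendsto (fun N => ENNReal.ofReal (Real.exp (precision σ n / m *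
        ∑ i ∈ Finset.range N, (y i * x i - x i ^ 2 / 2)))) atTop
        (𝓝 (ENNReal.ofReal (Real.exp (precision σ n / m * a)))) :=
      (ENNReal.continuous_ofReal.comp (Real.continuous_exp.comp
        (continuous_const.mul continuous_id))).continuousAt.tendsto.comp ha
    simp only [hF, hterm]
    rw [h1.limsup_eq, ← ENNReal.ofReal_pow (Real.exp_pos _).le, ← Real.exp_nat_mul]
    congr 2
    field_simp
  have key := smul_withDensity_seqGaussian (c := precision σ n) (fun i => priorVar_pos β i) hy
    (H := fun x => F x ^ m) ?_ ?_ (hFm.pow_const m)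
  · have hprior : (gaussianPrior β).map toSeq = P :=
      ell2Gaussian_map_toSeq (by simp) (summable_priorVar hβ)
    have hpost : localPosterior β σ n m y = (∫⁻ x, F x ^ m ∂P)⁻¹ •
        (gaussianPrior β).withDensity fun θ => F (toSeq θ) ^ m := by
      rw [← hprior, lintegral_map (hFm.pow_const m) measurable_toSeq]
      rfl
    refine eq_of_map_toSeq_eq ?_
    rw [ell2Gaussian_map_toSeq (summable_shrinkage_mul_sq hy _ _) (summable_postVar hβ _ _), hpost,
      Measure.map_smul, withDensity_comp_map_toSeq _ (H := fun x => F x ^ m) (hFm.pow_const m),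
      hprior, key]
    rfl
  · filter_upwards [hconv] with x ⟨a, ha⟩
    rw [hval x a ha]
    exact (ENNReal.continuous_ofReal.comp (Real.continuous_exp.comp
        (continuous_const.mul continuous_id))).continuousAt.tendsto.comp ha
  · filter_upwards [hconv] with x ⟨a, ha⟩
    rw [hval x a ha]
    exact (ENNReal.ofReal_pos.2 (Real.exp_pos _)).ne'

/-! ### Wasserstein barycenters of translates -/

section Barycenter

set_option linter.unusedSectionVars false

open scoped RealInnerProductSpace

variable {E : Type*} [NormedAddCommGroup E] [InnerProductSpace ℝ E] [CompleteSpace E]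
  [SecondCountableTopology E] [MeasurableSpace E] [BorelSpace E] {μ ν : Measure E}

lemma hasFiniteSecondMoment_of_memLp [IsProbabilityMeasure μ] (h : MemLp (fun x => x) 2 μ) :
    HasFiniteSecondMoment μ := by
  refine ⟨inferInstance, ?_⟩
  have := (eLpNorm_lt_top_iff_lintegral_rpow_enorm_lt_top (by simp) (by simp)).1 h.2
  simpa using this

lemma HasFiniteSecondMoment.map_add (h : HasFiniteSecondMoment μ) (v : E) :
    HasFiniteSecondMoment (μ.map fun x => x + v) := by
  have := h.1
  have hm : Measurable fun x : E => x + v := by fun_prop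
  have := Measure.isProbabilityMeasure_map (μ := μ) hm.aemeasurable
  refine hasFiniteSecondMoment_of_memLp ?_
  rw [memLp_map_measure_iff (g := fun x : E => x) aestronglyMeasurable_id hm.aemeasurable]
  exact h.memLp.add (memLp_const v)

section Coupling

variable {κ : Measure (E × E)}

lemma isProbabilityMeasure_coupling (hμ : IsProbabilityMeasure μ) (h1 : κ.map Prod.fst = μ) :
    IsProbabilityMeasure κ := by
  constructor
  rw [← Set.preimage_univ (f := Prod.fst), ← Measure.map_apply measurable_fst .univ, h1]
  simp

lemma memLp_coupling (hμ : HasFiniteSecondMoment μ) (hν : HasFiniteSecondMoment ν)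
    (h1 : κ.map Prod.fst = μ) (h2 : κ.map Prod.snd = ν) :
    MemLp (fun p : E × E => p.1) 2 κ ∧ MemLp (fun p : E × E => p.2) 2 κ := by
  constructor
  · have := hμ.memLp
    rw [← h1] at this
    exact (memLp_map_measure_iff (g := fun x : E => x) aestronglyMeasurable_id
      measurable_fst.aemeasurable).1 this
  · have := hν.memLp
    rw [← h2] at this
    exact (memLp_map_measure_iff (g := fun x : E => x) aestronglyMeasurable_id
      measurable_snd.aemeasurable).1 this

lemma integral_coupling_fst (h1 : κ.map Prod.fst = μ) : ∫ p, p.1 ∂κ = ∫ x, x ∂μ := by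
  rw [← h1, integral_map (f := fun x : E => x) measurable_fst.aemeasurable
    aestronglyMeasurable_id]

lemma integral_coupling_snd (h2 : κ.map Prod.snd = ν) : ∫ p, p.2 ∂κ = ∫ x, x ∂ν := by
  rw [← h2, integral_map (f := fun x : E => x) measurable_snd.aemeasurable
    aestronglyMeasurable_id]

lemma lintegral_enorm_sq_eq_ofReal {Ω : Type*} [MeasurableSpace Ω] {κ : Measure Ω} {f : Ω → E}
    (hf : MemLp f 2 κ) : ∫⁻ p, ‖f p‖ₑ ^ 2 ∂κ = ENNReal.ofReal (∫ p, ‖f p‖ ^ 2 ∂κ) := by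
  rw [ofReal_integral_eq_lintegral_ofReal (hf.integrable_norm_pow two_ne_zero)
    (ae_of_all _ fun _ => by positivity)]
  refine lintegral_congr fun p => ?_
  rw [← ofReal_norm, ENNReal.ofReal_pow (norm_nonneg _)]

end Coupling

lemma wassersteinSq_le {κ : Measure (E × E)} (h1 : κ.map Prod.fst = μ) (h2 : κ.map Prod.snd = ν) :
    wassersteinSq μ ν ≤ ∫⁻ p, ‖p.1 - p.2‖ₑ ^ 2 ∂κ :=
  iInf_le_of_le κ (iInf_le_of_le h1 (iInf_le_of_le h2 le_rfl))

lemma wassersteinSq_self (μ : Measure E) : wassersteinSq μ μ = 0 := by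
  have hm : Measurable fun x : E => (x, x) := by fun_prop
  refine le_antisymm ((wassersteinSq_le (κ := μ.map fun x => (x, x)) ?_ ?_).trans ?_) zero_le
  · rw [Measure.map_map measurable_fst hm]; exact Measure.map_id
  · rw [Measure.map_map measurable_snd hm]; exact Measure.map_id
  · rw [lintegral_map (by fun_prop) hm]; simp

lemma wassersteinSq_ne_top (hμ : HasFiniteSecondMoment μ) (hν : HasFiniteSecondMoment ν) :
    wassersteinSq μ ν ≠ ∞ := by
  have := hμ.1
  have := hν.1
  have h1 : (μ.prod ν).map Prod.fst = μ := by simp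
  have h2 : (μ.prod ν).map Prod.snd = ν := by simp
  have hL := memLp_coupling hμ hν h1 h2
  refine ne_top_of_le_ne_top ?_ (wassersteinSq_le h1 h2)
  rw [lintegral_enorm_sq_eq_ofReal (f := fun p : E × E => p.1 - p.2) (hL.1.sub hL.2)]
  exact ENNReal.ofReal_ne_top

/-- Shifting the second component of any coupling of `μ` and `ν` by `v` gives a coupling with the
translate. Its cost differs by an amount that depends on the coupling only through the two means, so
the infimum can be taken afterwards. -/
lemma toReal_wassersteinSq_map_add_le (hμ : HasFiniteSecondMoment μ)
    (hν : HasFiniteSecondMoment ν) (v : E) :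
    (wassersteinSq μ (ν.map fun x => x + v)).toReal ≤
      (wassersteinSq μ ν).toReal - 2 * ⟪∫ x, x ∂μ - ∫ x, x ∂ν, v⟫ + ‖v‖ ^ 2 := by
  set D := 2 * ⟪∫ x, x ∂μ - ∫ x, x ∂ν, v⟫ - ‖v‖ ^ 2 with hD
  have key : ENNReal.ofReal ((wassersteinSq μ (ν.map fun x => x + v)).toReal + D) ≤
      wassersteinSq μ ν := by
    refine le_iInf fun κ => le_iInf fun h1 => le_iInf fun h2 => ?_
    have := isProbabilityMeasure_coupling hμ.1 h1
    obtain ⟨hL1, hL2⟩ := memLp_coupling hμ hν h1 h2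
    have hm : Measurable fun p : E × E => (p.1, p.2 + v) := by fun_prop
    have hle := wassersteinSq_le (κ := κ.map fun p => (p.1, p.2 + v)) (μ := μ)
      (ν := ν.map fun x => x + v)
      (by rw [Measure.map_map measurable_fst hm]; exact h1)
      (by rw [Measure.map_map measurable_snd hm, ← h2, Measure.map_map (by fun_prop) (by fun_prop)]
          rfl)
    rw [lintegral_map (by fun_prop) hm] at hle
    simp only at hle
    have hL3 : MemLp (fun p : E × E => p.1 - (p.2 + v)) 2 κ := hL1.sub (hL2.add (memLp_const v))
    have hL4 : MemLp (fun p : E × E => p.1 - p.2) 2 κ := hL1.sub hL2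
    rw [lintegral_enorm_sq_eq_ofReal hL3] at hle
    rw [lintegral_enorm_sq_eq_ofReal hL4]
    refine ENNReal.ofReal_le_ofReal ?_
    have hle' := ENNReal.toReal_mono ENNReal.ofReal_ne_top hle
    rw [ENNReal.toReal_ofReal (integral_nonneg fun _ => by positivity)] at hle'
    have hI : ∫ p : E × E, ‖p.1 - (p.2 + v)‖ ^ 2 ∂κ =
        ∫ p : E × E, ‖p.1 - p.2‖ ^ 2 ∂κ - D := by
      have hpt : ∀ p : E × E, ‖p.1 - (p.2 + v)‖ ^ 2 =
          ‖p.1 - p.2‖ ^ 2 - 2 * ⟪p.1 - p.2, v⟫ + ‖v‖ ^ 2 := fun p => by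
        rw [← sub_sub, norm_sub_sq_real]
      have hi4 := hL4.integrable (by simp)
      have hin : ∫ p : E × E, ⟪p.1 - p.2, v⟫ ∂κ = ⟪∫ x, x ∂μ - ∫ x, x ∂ν, v⟫ := by
        rw [← integral_coupling_fst h1, ← integral_coupling_snd h2, ← integral_sub
          (hL1.integrable (by simp)) (hL2.integrable (by simp))]
        simp_rw [real_inner_comm v]
        exact integral_inner hi4 v
      simp_rw [hpt]
      have hi5 : Integrable (fun p : E × E => 2 * ⟪p.1 - p.2, v⟫) κ :=
        (hi4.inner_const v).const_mul 2
      have hi6 : Integrable (fun p : E × E => ‖p.1 - p.2‖ ^ 2 - 2 * ⟪p.1 - p.2, v⟫) κ :=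
        (hL4.integrable_norm_pow two_ne_zero).sub hi5
      rw [integral_add hi6 (integrable_const _),
        integral_sub (hL4.integrable_norm_pow two_ne_zero) hi5,
        integral_const_mul, hin]
      simp [hD]
      ring
    linarith
  have := (ENNReal.ofReal_le_iff_le_toReal (wassersteinSq_ne_top hμ hν)).1 key
  linarith

lemma integral_map_add (hν : HasFiniteSecondMoment ν) (v : E) :
    ∫ x, x ∂(ν.map fun x => x + v) = ∫ x, x ∂ν + v := by
  have := hν.1
  rw [integral_map (f := fun x : E => x) (by fun_prop) aestronglyMeasurable_id,
    integral_add (hν.memLp.integrable (by simp)) (integrable_const v)]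
  simp

/-- The effect of a translation of one of the measures on the squared Wasserstein distance. -/
lemma toReal_wassersteinSq_map_add (hμ : HasFiniteSecondMoment μ)
    (hν : HasFiniteSecondMoment ν) (v : E) :
    (wassersteinSq μ (ν.map fun x => x + v)).toReal =
      (wassersteinSq μ ν).toReal - 2 * ⟪∫ x, x ∂μ - ∫ x, x ∂ν, v⟫ + ‖v‖ ^ 2 := by
  refine le_antisymm (toReal_wassersteinSq_map_add_le hμ hν v) ?_
  -- The reverse inequality is the same bound for the translation back by `-v`.
  have h := toReal_wassersteinSq_map_add_le hμ (hν.map_add v) (-v)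
  have hback : (ν.map fun x => x + v).map (fun x => x + -v) = ν := by
    rw [Measure.map_map (by fun_prop) (by fun_prop)]
    convert Measure.map_id
    ext x; simp
  rw [hback, integral_map_add hν, inner_neg_right, norm_neg, ← sub_sub, inner_sub_left _ v v,
    real_inner_self_eq_norm_sq] at h
  linarith

/-- No optimal coupling is needed. A coupling of cost below `δ²` bounds the difference of the
characteristic functions at `t` by `‖t‖` times the mean distance, and `d ≤ δ + d² / δ` bounds that
mean by `2δ`. -/
lemma eq_of_wassersteinSq_eq_zero (hμ : HasFiniteSecondMoment μ) (hν : HasFiniteSecondMoment ν)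
    (h : wassersteinSq μ ν = 0) : μ = ν := by
  have := hμ.1
  have := hν.1
  refine Measure.ext_of_charFun (funext fun t => ?_)
  have key : ∀ δ : ℝ, 0 < δ → ‖charFun μ t - charFun ν t‖ ≤ ‖t‖ * (2 * δ) := fun δ hδ => by
    have hlt : wassersteinSq μ ν < ENNReal.ofReal (δ ^ 2) := by
      rw [h]; exact ENNReal.ofReal_pos.2 (by positivity)
    simp only [wassersteinSq, iInf_lt_iff] at hlt
    obtain ⟨κ, h1, h2, hκ⟩ := hlt
    have := isProbabilityMeasure_coupling hμ.1 h1
    obtain ⟨hL1, hL2⟩ := memLp_coupling hμ hν h1 h2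
    have hL : MemLp (fun p : E × E => p.1 - p.2) 2 κ := hL1.sub hL2
    rw [lintegral_enorm_sq_eq_ofReal hL, ENNReal.ofReal_lt_ofReal_iff (by positivity)] at hκ
    have hc1 : charFun μ t = ∫ p, Complex.exp (⟪p.1, t⟫ * Complex.I) ∂κ := by
      rw [charFun_apply, ← h1, integral_map measurable_fst.aemeasurable
        (by apply Measurable.aestronglyMeasurable; fun_prop)]
    have hc2 : charFun ν t = ∫ p, Complex.exp (⟪p.2, t⟫ * Complex.I) ∂κ := by
      rw [charFun_apply, ← h2, integral_map measurable_snd.aemeasurable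
        (by apply Measurable.aestronglyMeasurable; fun_prop)]
    have hb : ∀ f : E × E → E, Measurable f →
        Integrable (fun p => Complex.exp (⟪f p, t⟫ * Complex.I)) κ := fun f hf => by
      refine Integrable.of_bound (C := 1)
        (by apply Measurable.aestronglyMeasurable; fun_prop) (ae_of_all _ fun p => ?_)
      rw [Complex.norm_exp_ofReal_mul_I]
    rw [hc1, hc2, ← integral_sub (hb _ measurable_fst) (hb _ measurable_snd)]
    have hi := (hL.integrable (by simp)).norm
    calc _ ≤ ∫ p : E × E, ‖t‖ * ‖p.1 - p.2‖ ∂κ := by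
          refine norm_integral_le_of_norm_le (hi.const_mul _) (ae_of_all _ fun p => ?_)
          have h3 : Complex.exp (⟪p.1, t⟫ * Complex.I) - Complex.exp (⟪p.2, t⟫ * Complex.I) =
              Complex.exp (⟪p.2, t⟫ * Complex.I) *
                (Complex.exp (Complex.I * (⟪p.1 - p.2, t⟫ : ℝ)) - 1) := by
            rw [mul_sub, ← Complex.exp_add, inner_sub_left]
            push_cast
            ring_nf
          rw [h3, norm_mul, Complex.norm_exp_ofReal_mul_I, one_mul]
          refine (Real.norm_exp_I_mul_ofReal_sub_one_le).trans ?_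
          rw [Real.norm_eq_abs, mul_comm]
          exact abs_real_inner_le_norm _ _
      _ ≤ ‖t‖ * ∫ p : E × E, (δ + ‖p.1 - p.2‖ ^ 2 / δ) ∂κ := by
          rw [integral_const_mul]
          refine mul_le_mul_of_nonneg_left (integral_mono hi ((integrable_const _).add
            ((hL.integrable_norm_pow two_ne_zero).div_const _)) fun p => ?_) (norm_nonneg _)
          change ‖p.1 - p.2‖ ≤ δ + ‖p.1 - p.2‖ ^ 2 / δ
          rw [← sub_nonneg]
          have h4 : δ + ‖p.1 - p.2‖ ^ 2 / δ - ‖p.1 - p.2‖ =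
            (δ ^ 2 + ‖p.1 - p.2‖ ^ 2 - δ * ‖p.1 - p.2‖) / δ := by field_simp
          rw [h4]
          refine div_nonneg ?_ hδ.le
          nlinarith [sq_nonneg (δ - ‖p.1 - p.2‖), norm_nonneg (p.1 - p.2)]
      _ ≤ ‖t‖ * (2 * δ) := by
          refine mul_le_mul_of_nonneg_left ?_ (norm_nonneg _)
          rw [integral_add (integrable_const _)
            ((hL.integrable_norm_pow two_ne_zero).div_const _), integral_div]
          have : (∫ p : E × E, ‖p.1 - p.2‖ ^ 2 ∂κ) / δ ≤ δ := by
            rw [div_le_iff₀ hδ]; nlinarith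
          simp
          linarith
  have hT : Tendsto (fun δ : ℝ => ‖t‖ * (2 * δ)) (𝓝[>] 0) (𝓝 0) := by
    have : Continuous fun δ : ℝ => ‖t‖ * (2 * δ) := by fun_prop
    simpa using (this.tendsto 0).mono_left nhdsWithin_le_nhds
  have h0 := ge_of_tendsto hT (eventually_mem_nhdsWithin.mono fun δ hδ => key δ hδ)
  exact sub_eq_zero.1 (norm_le_zero_iff.1 h0)

variable {m : ℕ}

/-- For translates of one measure, the objective of the barycenter problem is, up to a constant,
the squared distance to the translate by the average. -/
lemma toReal_barycenterObjective (hm : 1 ≤ m) (hμ : HasFiniteSecondMoment μ)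
    (hν : HasFiniteSecondMoment ν) (hν0 : ∫ x, x ∂ν = 0) (v : Fin m → E) :
    barycenterObjective (fun j => ν.map fun x => x + v j) μ ≠ ∞ ∧
    (barycenterObjective (fun j => ν.map fun x => x + v j) μ).toReal =
      (wassersteinSq μ (ν.map fun x => x + (m : ℝ)⁻¹ • ∑ j, v j)).toReal +
        ((m : ℝ)⁻¹ * ∑ j, ‖v j‖ ^ 2 - ‖(m : ℝ)⁻¹ • ∑ j, v j‖ ^ 2) := by
  have hm' : (m : ℝ) ≠ 0 := by positivity
  have hfin : ∀ j, wassersteinSq μ (ν.map fun x => x + v j) ≠ ∞ := fun j =>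
    wassersteinSq_ne_top hμ (hν.map_add _)
  refine ⟨ENNReal.mul_ne_top (by simp; omega) (by simpa using hfin), ?_⟩
  rw [barycenterObjective, ENNReal.toReal_mul, ENNReal.toReal_sum fun j _ => hfin j]
  -- Each summand becomes `W₂²(μ, ν)` plus terms in `v j`, and the one term that mixes `μ` and `v j`
  -- is linear in `v j`. So averaging over `j` sees `μ` only together with the average of the `v j`.
  simp_rw [toReal_wassersteinSq_map_add hμ hν, hν0, sub_zero]
  rw [Finset.sum_add_distrib, Finset.sum_sub_distrib, ← Finset.mul_sum, ← inner_sum,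
    real_inner_smul_right]
  simp
  field_simp

/-- The barycenter of translates of one measure is the translate by the average. -/
theorem isWassersteinBarycenter_map_add_iff (hm : 1 ≤ m) (hν : HasFiniteSecondMoment ν)
    (hν0 : ∫ x, x ∂ν = 0) (v : Fin m → E) :
    IsWassersteinBarycenter (fun j => ν.map fun x => x + v j) μ ↔
      μ = ν.map fun x => x + (m : ℝ)⁻¹ • ∑ j, v j := by
  set ρ := ν.map fun x => x + (m : ℝ)⁻¹ • ∑ j, v j with hρ
  have hρm : HasFiniteSecondMoment ρ := hν.map_add _
  have hobj := toReal_barycenterObjective hm hρm hν hν0 v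
  rw [← hρ, wassersteinSq_self, ENNReal.toReal_zero, zero_add] at hobj
  constructor
  · rintro ⟨hμ, hmin⟩
    have h1 := ENNReal.toReal_mono hobj.1 (hmin ρ hρm)
    rw [hobj.2, (toReal_barycenterObjective hm hμ hν hν0 v).2, ← hρ] at h1
    refine eq_of_wassersteinSq_eq_zero hμ hρm ?_
    have h2 : (wassersteinSq μ ρ).toReal = 0 := le_antisymm (by linarith) ENNReal.toReal_nonneg
    exact ((ENNReal.toReal_eq_zero_iff _).1 h2).resolve_right (wassersteinSq_ne_top hμ hρm)
  · rintro rfl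
    refine ⟨hρm, fun η hη => ?_⟩
    have h1 := toReal_barycenterObjective hm hη hν hν0 v
    rw [← ENNReal.toReal_le_toReal hobj.1 h1.1, hobj.2, h1.2, ← hρ]
    exact le_add_of_nonneg_left ENNReal.toReal_nonneg

end Barycenter

/-! ### Credible radii of Gaussian product measures -/

section Radius

variable {s : ℕ → ℝ≥0}

/-- Replace the first coordinate of a sequence in `ℓ²`. -/
def Ell2.replaceZero (θ : Ell2) (a : ℝ) : Ell2 := θ + lp.single 2 0 (a - θ 0)

lemma toSeq_replaceZero (θ : Ell2) (a : ℝ) :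
    toSeq (θ.replaceZero a) = Function.update (toSeq θ) 0 a := by
  ext i
  by_cases hi : i = 0
  · subst hi
    simp [toSeq, replaceZero]
  · simp [toSeq, replaceZero, hi]

lemma measurable_replaceZero : Measurable fun p : Ell2 × ℝ => p.1.replaceZero p.2 := by
  have h : Measurable fun p : Ell2 × ℝ => p.2 - p.1 0 :=
    measurable_snd.sub ((continuous_apply 0).measurable.comp measurable_fst)
  exact measurable_fst.add
    ((lp.isometry_single (E := fun _ : ℕ => ℝ) 0).continuous.measurable.comp h)

/-- The squared norm of all coordinates but the first. -/
def Ell2.restSq (θ : Ell2) : ℝ := ∑' i, θ (i + 1) ^ 2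

lemma norm_sq_eq_add_restSq (θ : Ell2) : ‖θ‖ ^ 2 = θ 0 ^ 2 + θ.restSq := by
  rw [norm_sq_eq_tsum, (summable_sq θ).tsum_eq_zero_add, restSq]

lemma norm_sq_replaceZero (θ : Ell2) (a : ℝ) : ‖θ.replaceZero a‖ ^ 2 = a ^ 2 + θ.restSq := by
  have h : ∀ i, θ.replaceZero a i = Function.update (toSeq θ) 0 a i :=
    fun i => congrFun (toSeq_replaceZero θ a) i
  rw [norm_sq_eq_add_restSq, restSq]
  simp [h, restSq, toSeq]

/-- Resampling the first coordinate leaves a Gaussian product measure invariant. -/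
lemma map_replaceZero (hs : Summable s) :
    ((ell2Gaussian (fun _ => 0) s).prod (gaussianReal 0 (s 0))).map
      (fun p => p.1.replaceZero p.2) = ell2Gaussian (fun _ => 0) s := by
  classical
  have := isProbabilityMeasure_ell2Gaussian (μ := fun _ => 0) (by simp) hs
  refine eq_of_map_toSeq_eq ?_
  rw [ell2Gaussian_map_toSeq (by simp) hs,
    Measure.map_map measurable_toSeq measurable_replaceZero]
  refine Measure.eq_infinitePi _ fun S t ht => ?_
  have hbox : ∀ S : Finset ℕ, MeasurableSet ((S : Set ℕ).pi t) := fun S =>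
    MeasurableSet.pi S.countable_toSet fun i _ => ht i
  have hE : ∀ S : Finset ℕ, ell2Gaussian (fun _ => 0) s (toSeq ⁻¹' (S : Set ℕ).pi t) =
      ∏ i ∈ S, gaussianReal 0 (s i) (t i) := fun S => by
    rw [← Measure.map_apply measurable_toSeq (hbox S), ell2Gaussian_map_toSeq (by simp) hs]
    exact Measure.infinitePi_pi _ fun i _ => ht i
  rw [Measure.map_apply (measurable_toSeq.comp measurable_replaceZero) (hbox S)]
  by_cases h0 : 0 ∈ S
  · have hset : (toSeq ∘ fun p : Ell2 × ℝ => p.1.replaceZero p.2) ⁻¹' (S : Set ℕ).pi t =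
        (toSeq ⁻¹' ((S.erase 0 : Finset ℕ) : Set ℕ).pi t) ×ˢ t 0 := by
      ext ⟨θ, a⟩
      simp only [Set.mem_preimage, Function.comp_apply, toSeq_replaceZero, Set.mem_pi,
        Set.mem_prod, Finset.mem_coe, Finset.mem_erase]
      constructor
      · refine fun h => ⟨fun i hi => ?_, by simpa using h 0 h0⟩
        simpa [hi.1] using h i hi.2
      · rintro ⟨h1, h2⟩ i hi
        by_cases hi0 : i = 0
        · subst hi0; simpa using h2
        · simpa [hi0] using h1 i ⟨hi0, hi⟩
    rw [hset, Measure.prod_prod, hE, Finset.prod_erase_mul _ _ h0]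
  · have hset : (toSeq ∘ fun p : Ell2 × ℝ => p.1.replaceZero p.2) ⁻¹' (S : Set ℕ).pi t =
        (toSeq ⁻¹' (S : Set ℕ).pi t) ×ˢ Set.univ := by
      ext ⟨θ, a⟩
      simp only [Set.mem_preimage, Function.comp_apply, toSeq_replaceZero, Set.mem_pi,
        Set.mem_prod, Finset.mem_coe, Set.mem_univ, and_true]
      refine forall₂_congr fun i hi => ?_
      have hi0 : i ≠ 0 := fun h => h0 (h ▸ hi)
      simp [hi0]
    rw [hset, Measure.prod_prod, hE, measure_univ, mul_one]

/-- Fubini for the resampled coordinate: questions about the law of the norm reduce to one real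
variable with a positive density. -/
lemma ae_replaceZero (hs : Summable s) {p : Ell2 → Prop}
    (h : ∀ᵐ θ ∂ell2Gaussian (fun _ => 0) s, p θ) :
    ∀ᵐ θ ∂ell2Gaussian (fun _ => 0) s, ∀ᵐ a ∂gaussianReal 0 (s 0), p (θ.replaceZero a) := by
  have := isProbabilityMeasure_ell2Gaussian (μ := fun _ => 0) (by simp) hs
  rw [← map_replaceZero hs] at h
  exact Measure.ae_ae_of_ae_prod (ae_of_ae_map measurable_replaceZero.aemeasurable h)

/-- With the other coordinates fixed, at most two values of the first one put `θ` on the sphere. The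
distribution function of the norm is thus continuous. -/
lemma ell2Gaussian_norm_eq (hs : Summable s) (h0 : 0 < s 0) (r : ℝ) :
    ell2Gaussian (fun _ => 0) s {θ | ‖θ‖ = r} = 0 := by
  have := isProbabilityMeasure_ell2Gaussian (μ := fun _ => 0) (by simp) hs
  have hm : MeasurableSet {θ : Ell2 | ‖θ‖ = r} := measurableSet_eq_fun measurable_norm (by fun_prop)
  rw [← map_replaceZero hs, Measure.map_apply measurable_replaceZero hm,
    Measure.measure_prod_null (measurable_replaceZero hm)]
  refine ae_of_all _ fun θ => gaussianReal_absolutelyContinuous 0 h0.ne' ?_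
  refine Set.Finite.measure_zero (Set.Finite.subset
    (Set.toFinite {√(r ^ 2 - θ.restSq), -√(r ^ 2 - θ.restSq)}) fun a ha => ?_) _
  have h1 : ‖θ.replaceZero a‖ = r := ha
  have h2 := norm_sq_replaceZero θ a
  rw [h1] at h2
  have h3 : r ^ 2 - θ.restSq = a ^ 2 := by linarith
  rw [h3, Real.sqrt_sq_eq_abs]
  rcases abs_cases a with h | h <;> simp [h.1]

/-- From a point of the inner ball, a whole interval of values of the first coordinate leads into
the annulus. If the annulus were null, almost no point could lie in the inner ball. -/
lemma ell2Gaussian_annulus_ne_zero (hs : Summable s) (h0 : 0 < s 0) {r₁ r₂ : ℝ} (hr₁ : 0 ≤ r₁)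
    (hr : r₁ < r₂) (hpos : ell2Gaussian (fun _ => 0) s {θ | ‖θ‖ ≤ r₁} ≠ 0) :
    ell2Gaussian (fun _ => 0) s {θ | r₁ < ‖θ‖ ∧ ‖θ‖ ≤ r₂} ≠ 0 := by
  intro hz
  refine hpos ?_
  have h1 : ∀ᵐ θ ∂ell2Gaussian (fun _ => 0) s, ¬(r₁ < ‖θ‖ ∧ ‖θ‖ ≤ r₂) :=
    measure_eq_zero_iff_ae_notMem.1 hz
  refine measure_eq_zero_iff_ae_notMem.2 ?_
  filter_upwards [ae_replaceZero hs h1] with θ hθ hle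
  have hR : θ.restSq ≤ r₁ ^ 2 := by
    have h2 : ‖θ‖ ^ 2 ≤ r₁ ^ 2 := pow_le_pow_left₀ (norm_nonneg _) hle 2
    rw [norm_sq_eq_add_restSq] at h2
    nlinarith [sq_nonneg (θ 0)]
  have hvol : ∀ᵐ a, ¬(r₁ < ‖θ.replaceZero a‖ ∧ ‖θ.replaceZero a‖ ≤ r₂) :=
    (gaussianReal_absolutelyContinuous' 0 h0.ne').ae_le hθ
  have hlt : √(r₁ ^ 2 - θ.restSq) < √(r₂ ^ 2 - θ.restSq) :=
    Real.sqrt_lt_sqrt (by linarith) (by nlinarith)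
  have hnull : volume (Set.Ioo √(r₁ ^ 2 - θ.restSq) √(r₂ ^ 2 - θ.restSq)) = 0 := by
    refine measure_eq_zero_iff_ae_notMem.2 ?_
    filter_upwards [hvol] with a ha ⟨hm1, hm2⟩
    have ha0 : 0 ≤ a := (Real.sqrt_nonneg _).trans hm1.le
    rw [Real.sqrt_lt' (lt_of_le_of_lt (Real.sqrt_nonneg _) hm1)] at hm1
    rw [Real.lt_sqrt ha0] at hm2
    refine ha ⟨lt_of_pow_lt_pow_left₀ 2 (norm_nonneg _) ?_,
      le_of_lt (lt_of_pow_lt_pow_left₀ 2 (hr₁.trans hr.le) ?_)⟩ <;>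
    · rw [norm_sq_replaceZero]; linarith
  rw [Real.volume_Ioo, ENNReal.ofReal_eq_zero] at hnull
  linarith

/-- Existence is the intermediate value theorem for the distribution function of the norm, which is
continuous and vanishes at `0`. Uniqueness holds because annuli outside a charged ball are charged.
-/
lemma existsUnique_ball_mass (hs : Summable s) (h0 : 0 < s 0) {γ : ℝ} (hγ : γ ∈ Set.Ioo (0 : ℝ) 1) :
    ∃! r, 0 ≤ r ∧ ell2Gaussian (fun _ => 0) s {θ | ‖θ‖ ≤ r} = ENNReal.ofReal (1 - γ) := by
  have := isProbabilityMeasure_ell2Gaussian (μ := fun _ => 0) (by simp) hs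
  set G := ell2Gaussian (fun _ => 0) s with hG
  set ρ := G.map fun θ => ‖θ‖ with hρ
  have : IsProbabilityMeasure ρ := Measure.isProbabilityMeasure_map measurable_norm.aemeasurable
  have hcdf : ∀ r, ENNReal.ofReal (cdf ρ r) = G {θ | ‖θ‖ ≤ r} := fun r => by
    rw [ofReal_cdf, hρ, Measure.map_apply measurable_norm measurableSet_Iic]
    rfl
  have hcont : Continuous (cdf ρ) := by
    refine continuous_iff_continuousAt.2 fun r => ?_
    rw [(monotone_cdf ρ).continuousAt_iff_leftLim_eq_rightLim]
    have h1 : (cdf ρ).measure {r} = 0 := by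
      rw [measure_cdf, hρ, Measure.map_apply measurable_norm (measurableSet_singleton r)]
      exact ell2Gaussian_norm_eq hs h0 r
    rw [StieltjesFunction.measure_singleton, ENNReal.ofReal_eq_zero] at h1
    have h2 := (monotone_cdf ρ).leftLim_le (le_refl r)
    rw [StieltjesFunction.rightLim_eq]
    linarith
  have hzero : cdf ρ 0 = 0 := by
    have h1 := hcdf 0
    have h2 : {θ : Ell2 | ‖θ‖ ≤ 0} = {θ | ‖θ‖ = 0} := by
      ext θ; simp
    rw [h2, ell2Gaussian_norm_eq hs h0, ENNReal.ofReal_eq_zero] at h1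
    exact le_antisymm h1 (cdf_nonneg _ _)
  obtain ⟨b, hb0, hb⟩ : ∃ b : ℝ, 0 ≤ b ∧ 1 - γ ≤ cdf ρ b := by
    have h1 := (tendsto_cdf_atTop ρ).eventually (lt_mem_nhds (show 1 - γ < 1 by linarith [hγ.1]))
    obtain ⟨b, h2, h3⟩ := (h1.and (eventually_ge_atTop 0)).exists
    exact ⟨b, h3, h2.le⟩
  obtain ⟨r, hr, hrv⟩ := intermediate_value_Icc hb0 hcont.continuousOn
    (show 1 - γ ∈ Set.Icc (cdf ρ 0) (cdf ρ b) from ⟨by rw [hzero]; linarith [hγ.2], hb⟩)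
  have hpos : ENNReal.ofReal (1 - γ) ≠ 0 := by
    simpa using hγ.2
  have huniq : ∀ r₁ r₂ : ℝ, 0 ≤ r₁ → r₁ < r₂ → G {θ | ‖θ‖ ≤ r₁} = ENNReal.ofReal (1 - γ) →
      G {θ | ‖θ‖ ≤ r₂} ≠ ENNReal.ofReal (1 - γ) := by
    intro r₁ r₂ hr₁ hr h1 h2
    refine ell2Gaussian_annulus_ne_zero hs h0 hr₁ hr (by rw [← hG, h1]; exact hpos) ?_
    have hset : {θ : Ell2 | r₁ < ‖θ‖ ∧ ‖θ‖ ≤ r₂} = {θ | ‖θ‖ ≤ r₂} \ {θ | ‖θ‖ ≤ r₁} := by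
      ext θ; simp [and_comm]
    have hsub : {θ : Ell2 | ‖θ‖ ≤ r₁} ⊆ {θ | ‖θ‖ ≤ r₂} := fun θ hθ => le_trans hθ hr.le
    have hm : MeasurableSet {θ : Ell2 | ‖θ‖ ≤ r₁} :=
      measurableSet_le measurable_norm measurable_const
    rw [hset, measure_sdiff hsub hm.nullMeasurableSet (measure_ne_top _ _),
      ← hG, h1, h2, tsub_self]
  refine ⟨r, ⟨hr.1, by rw [← hcdf, hrv]⟩, fun r' hr' => ?_⟩
  have hrG : G {θ | ‖θ‖ ≤ r} = ENNReal.ofReal (1 - γ) := by rw [← hcdf, hrv]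
  rcases lt_trichotomy r' r with h | h | h
  · exact (huniq _ _ hr'.1 h hr'.2 hrG).elim
  · exact h
  · exact (huniq _ _ hr.1 h hrG hr'.2).elim

lemma ell2Gaussian_ball_center (v : Ell2) (hs : Summable s) (r : ℝ) :
    ell2Gaussian v s {θ | ‖θ - posteriorMean (ell2Gaussian v s)‖ ≤ r} =
      ell2Gaussian (fun _ => 0) s {θ | ‖θ‖ ≤ r} := by
  rw [posteriorMean_ell2Gaussian v hs, ← ell2Gaussian_map_add v hs,
    Measure.map_apply (measurable_add_const v)
      (measurableSet_le (by fun_prop) (by fun_prop))]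
  simp

theorem existsUnique_isCredibleRadius (v : Ell2) (hs : Summable s) (h0 : 0 < s 0) {γ : ℝ}
    (hγ : γ ∈ Set.Ioo (0 : ℝ) 1) : ∃! r, IsCredibleRadius (ell2Gaussian v s) γ r := by
  simp only [IsCredibleRadius, ell2Gaussian_ball_center v hs]
  exact existsUnique_ball_mass hs h0 hγ

lemma isCredibleRadius_credibleRadius {μ : Measure Ell2} {γ : ℝ}
    (h : ∃! r, IsCredibleRadius μ γ r) : IsCredibleRadius μ γ (credibleRadius μ γ) := by
  obtain ⟨r, hr, hu⟩ := h
  have : {r | IsCredibleRadius μ γ r} = {r} := by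
    ext r'; exact ⟨fun h => hu r' h, fun h => by rw [h]; exact hr⟩
  rw [credibleRadius, this, csInf_singleton]
  exact hr

/-! ### Small ball probabilities -/

/-- The length of the interval times the maximum of the density; the result does not depend on `v`.
-/
lemma gaussianReal_sq_le {v : ℝ≥0} (hv : 0 < v) {c : ℝ} (hc : 0 ≤ c) :
    gaussianReal 0 v {x | x ^ 2 ≤ 2 * c * v} ≤ ENNReal.ofReal (2 * √c) := by
  have hv' : (0 : ℝ) < v := hv
  have hsub : {x : ℝ | x ^ 2 ≤ 2 * c * v} ⊆ Set.Icc (-√(2 * c * v)) √(2 * c * v) :=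
    fun x hx => abs_le.1 (Real.abs_le_sqrt hx)
  refine (measure_mono hsub).trans ?_
  rw [gaussianReal_apply _ hv.ne']
  have hpdf : ∀ x, gaussianPDF 0 v x ≤ ENNReal.ofReal (√(2 * Real.pi * v))⁻¹ := fun x => by
    refine ENNReal.ofReal_le_ofReal ?_
    rw [gaussianPDFReal]
    refine mul_le_of_le_one_right (by positivity) (Real.exp_le_one_iff.2 ?_)
    rw [neg_div]
    exact neg_nonpos.2 (by positivity)
  calc _ ≤ ∫⁻ _ in Set.Icc (-√(2 * c * v)) √(2 * c * v),
        ENNReal.ofReal (√(2 * Real.pi * v))⁻¹ := lintegral_mono hpdf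
    _ = ENNReal.ofReal ((√(2 * Real.pi * v))⁻¹ * (2 * √(2 * c * v))) := by
      rw [setLIntegral_const, Real.volume_Icc, ← ENNReal.ofReal_mul (by positivity)]
      congr 1; ring
    _ ≤ ENNReal.ofReal (2 * √c) := by
      refine ENNReal.ofReal_le_ofReal ?_
      rw [inv_mul_le_iff₀ (by positivity)]
      have h1 : √(2 * c * v) ≤ √(2 * Real.pi * v * c) := by
        refine Real.sqrt_le_sqrt ?_
        have : 1 ≤ Real.pi := by linarith [Real.pi_gt_three]
        nlinarith [mul_nonneg hc hv'.le]
      rw [Real.sqrt_mul (x := 2 * Real.pi * v) (by positivity) c] at h1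
      linarith

/-- A Gaussian product measure on `ℓ²` puts little mass on a ball whose squared radius is a small
fraction of the trace of the covariance, uniformly over the variances. -/
lemma ell2Gaussian_small_ball (hs : Summable s) (hpos : ∀ i, 0 < s i) {c : ℝ} (hc : 0 < c) :
    ell2Gaussian (fun _ => 0) s {θ | ‖θ‖ ^ 2 ≤ c * ∑' i, (s i : ℝ)} ≤
      ENNReal.ofReal (4 * √c) := by
  have hs' : Summable fun i => (s i : ℝ) := NNReal.summable_coe.2 hs
  set T := ∑' i, (s i : ℝ) with hT
  have hTpos : 0 < T := hs'.tsum_pos (fun i => (s i).coe_nonneg) 0 (hpos 0)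
  set A : ℕ → Set ℝ := fun i => {x | x ^ 2 ≤ 2 * c * s i} with hA
  have hAm : ∀ i, MeasurableSet (A i) := fun i =>
    measurableSet_le (by fun_prop) (by fun_prop)
  -- `X` is the variance carried by the coordinates with `x i ^ 2 ≤ 2 * c * s i`. In the small ball
  -- the other coordinates carry at most `T / 2`, so `X ≥ T / 2`. The mean of `X` is at most `2√c
  -- T`, and Markov's inequality gives `4√c`. Only the marginals enter.
  set X : (ℕ → ℝ) → ℝ≥0∞ := fun x => ∑' i, (s i : ℝ≥0∞) * (A i).indicator 1 (x i) with hX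
  have hXi : ∀ i, Measurable fun x : ℕ → ℝ => (s i : ℝ≥0∞) * (A i).indicator 1 (x i) := fun i =>
    ((measurable_one.indicator (hAm i)).comp (measurable_pi_apply i)).const_mul _
  have hXm : Measurable X := Measurable.tsum hXi
  have hsubset : {θ : Ell2 | ‖θ‖ ^ 2 ≤ c * T} ⊆ {θ | ENNReal.ofReal (T / 2) ≤ X (toSeq θ)} := by
    intro θ hθ
    have hθ' : ‖θ‖ ^ 2 ≤ c * T := hθ
    set g : ℕ → ℝ := fun i => (A i).indicator 1 (toSeq θ i) with hg
    have hg_in : ∀ i, toSeq θ i ∈ A i → g i = 1 := fun i hi => by simp [hg, hi]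
    have hg_out : ∀ i, toSeq θ i ∉ A i → g i = 0 := fun i hi => by simp [hg, hi]
    have hg0 : ∀ i, 0 ≤ (s i : ℝ) * g i := fun i => by
      by_cases hi : toSeq θ i ∈ A i
      · simp [hg_in i hi]
      · simp [hg_out i hi]
    have hg1 : ∀ i, (s i : ℝ) * g i ≤ s i := fun i => by
      by_cases hi : toSeq θ i ∈ A i
      · simp [hg_in i hi]
      · simp [hg_out i hi]
    have hle : ∀ i, (s i : ℝ) ≤ s i * g i + θ i ^ 2 / (2 * c) := fun i => by
      by_cases hi : toSeq θ i ∈ A i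
      · rw [hg_in i hi, mul_one, le_add_iff_nonneg_right]
        positivity
      · rw [hg_out i hi, mul_zero, zero_add, le_div_iff₀ (by positivity)]
        have : 2 * c * s i < θ i ^ 2 := not_le.1 hi
        linarith
    have hsum1 : Summable fun i => (s i : ℝ) * g i := hs'.of_nonneg_of_le hg0 hg1
    have hsum2 := (summable_sq θ).div_const (2 * c)
    have h1 := hs'.tsum_le_tsum hle (hsum1.add hsum2)
    rw [hsum1.tsum_add hsum2, tsum_div_const, ← norm_sq_eq_tsum] at h1
    have h2 : ‖θ‖ ^ 2 / (2 * c) ≤ T / 2 := by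
      rw [div_le_iff₀ (by positivity)]; linarith
    have h3 : X (toSeq θ) = ENNReal.ofReal (∑' i, (s i : ℝ) * g i) := by
      rw [ENNReal.ofReal_tsum_of_nonneg hg0 hsum1]
      refine tsum_congr fun i => ?_
      by_cases hi : toSeq θ i ∈ A i
      · simp [hg_in i hi, hi]
      · simp [hg_out i hi, hi]
    change ENNReal.ofReal (T / 2) ≤ X (toSeq θ)
    rw [h3]
    exact ENNReal.ofReal_le_ofReal (by linarith)
  have hint : ∫⁻ θ, X (toSeq θ) ∂ell2Gaussian (fun _ => 0) s ≤
      ENNReal.ofReal T * ENNReal.ofReal (2 * √c) := by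
    rw [lintegral_apply_ell2Gaussian (by simp) hs hXm, hX,
      lintegral_tsum fun i => (hXi i).aemeasurable, hT,
      ENNReal.ofReal_tsum_of_nonneg (fun i => (s i).coe_nonneg) hs', ← ENNReal.tsum_mul_right]
    refine ENNReal.tsum_le_tsum fun i => ?_
    have h1 : ∫⁻ x, (A i).indicator 1 (x i) ∂seqGaussian (fun _ => 0) s =
        gaussianReal 0 (s i) (A i) := by
      rw [← lintegral_indicator_one (hAm i), ← seqGaussian_map_eval (fun _ => 0) s i,
        lintegral_map (measurable_one.indicator (hAm i)) (measurable_pi_apply i)]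
    have hm : Measurable fun x : ℕ → ℝ => (A i).indicator (1 : ℝ → ℝ≥0∞) (x i) :=
      (measurable_one.indicator (hAm i)).comp (measurable_pi_apply i)
    rw [lintegral_const_mul _ hm, h1, ENNReal.ofReal_coe_nnreal]
    gcongr
    exact gaussianReal_sq_le (hpos i) hc.le
  have hmarkov := (mul_le_mul_right (measure_mono hsubset) _).trans
    ((mul_meas_ge_le_lintegral (μ := ell2Gaussian (fun _ => 0) s)
      (hXm.comp measurable_toSeq) (ENNReal.ofReal (T / 2))).trans hint)
  have hT2 : ENNReal.ofReal (T / 2) ≠ 0 := by simpa using hTpos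
  rw [← ENNReal.mul_le_mul_iff_right hT2 ENNReal.ofReal_ne_top]
  refine hmarkov.trans (le_of_eq ?_)
  rw [← ENNReal.ofReal_mul hTpos.le, ← ENNReal.ofReal_mul (by positivity)]
  congr 1; ring

/-- The squared credible radius is at least a fraction of the trace of the covariance. -/
theorem credibleRadius_sq_gt (v : Ell2) (hs : Summable s) (hpos : ∀ i, 0 < s i) {γ : ℝ}
    (hγ : γ ∈ Set.Ioo (0 : ℝ) 1) :
    ((1 - γ) / 8) ^ 2 * ∑' i, (s i : ℝ) < credibleRadius (ell2Gaussian v s) γ ^ 2 := by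
  have hγ' : 0 < 1 - γ := sub_pos.2 hγ.2
  obtain ⟨hr0, hr⟩ := isCredibleRadius_credibleRadius
    (existsUnique_isCredibleRadius v hs (hpos 0) hγ)
  rw [ell2Gaussian_ball_center v hs] at hr
  by_contra! hle
  -- This `c` makes `4√c = (1 - γ) / 2`, strictly less than the mass `1 - γ` of the credible ball.
  have h1 := ell2Gaussian_small_ball hs hpos (c := ((1 - γ) / 8) ^ 2) (by positivity)
  rw [Real.sqrt_sq (by positivity)] at h1
  have h2 : ENNReal.ofReal (1 - γ) ≤ ENNReal.ofReal (4 * ((1 - γ) / 8)) := by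
    rw [← hr]
    refine (measure_mono fun θ hθ => ?_).trans h1
    exact (pow_le_pow_left₀ (norm_nonneg _) hθ 2).trans hle
  rw [ENNReal.ofReal_le_ofReal_iff (by positivity)] at h2
  linarith

end Radius

/-! ### The posterior spread -/

/-- Comparison with the integral of `x ^ (-1 - 2β)` over `[N, ∞)`. The sum starts at `N + 1`, the
mathematical index of the coordinate `N`. -/
lemma sum_range_rpow_le {β : ℝ} (hβ : 0 < β) {N : ℕ} (hN : 1 ≤ N) (a : ℕ) :
    ∑ j ∈ Finset.range a, ((N : ℝ) + (j + 1 : ℕ)) ^ (-1 - 2 * β) ≤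
      (N : ℝ) ^ (-(2 * β)) / (2 * β) := by
  have hN' : (0 : ℝ) < N := by exact_mod_cast hN
  have hle : (N : ℝ) ≤ N + a := by simp
  have hanti : AntitoneOn (fun x : ℝ => x ^ (-1 - 2 * β)) (Set.Icc (N : ℝ) (N + a)) :=
    fun x hx y _ hxy => Real.rpow_le_rpow_of_nonpos (hN'.trans_le hx.1) hxy (by linarith)
  refine (hanti.sum_le_integral).trans ?_
  have h0 : (0 : ℝ) ∉ Set.uIcc (N : ℝ) (N + a) := by
    rw [Set.uIcc_of_le hle]
    exact fun h => absurd h.1 (not_le.2 hN')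
  rw [integral_rpow (Or.inr ⟨by linarith, h0⟩)]
  have h1 : -1 - 2 * β + 1 = -(2 * β) := by ring
  rw [h1, div_neg, ← neg_div, neg_sub]
  gcongr
  have : 0 ≤ ((N : ℝ) + a) ^ (-(2 * β)) := by positivity
  linarith

lemma postVar_le_priorVar (β σ : ℝ) (n i : ℕ) : (postVar β σ n i : ℝ) ≤ priorVar β i := by
  exact_mod_cast tiltVar_le _ _

lemma shrinkage_le_one (β σ : ℝ) (n i : ℕ) : shrinkage β σ n i ≤ 1 := by
  exact_mod_cast mul_tiltVar_le_one _ _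

lemma shrinkage_nonneg (β σ : ℝ) (n i : ℕ) : 0 ≤ shrinkage β σ n i := by
  unfold shrinkage; positivity

lemma postVar_eq (β σ : ℝ) (n i : ℕ) :
    (postVar β σ n i : ℝ) = priorVar β i * (1 - shrinkage β σ n i) := by
  have h : (1 : ℝ) + precision σ n * priorVar β i ≠ 0 := by positivity
  simp only [shrinkage, postVar, tiltVar]
  push_cast
  field_simp
  ring

lemma postVar_le_div {σ : ℝ} (hσ : 0 < σ) (β : ℝ) {n : ℕ} (hn : 1 ≤ n) (i : ℕ) :
    (postVar β σ n i : ℝ) ≤ σ ^ 2 / n := by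
  have h := shrinkage_le_one β σ n i
  have hn' : (0 : ℝ) < n := by exact_mod_cast hn
  rw [shrinkage, coe_precision, div_mul_eq_mul_div, div_le_one (by positivity)] at h
  rw [le_div_iff₀ hn']
  linarith

/-- The posterior spread is of the order `n ^ (-2β / (1 + 2β))`. -/
theorem tsum_postVar_le {β σ : ℝ} (hβ : 0 < β) (hσ : 0 < σ) {n : ℕ} (hn : 1 ≤ n) :
    ∑' i, (postVar β σ n i : ℝ) ≤
      (2 * σ ^ 2 + 1 / (2 * β)) * ((n : ℝ) ^ (-(β / (1 + 2 * β)))) ^ 2 := by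
  have hn' : (1 : ℝ) ≤ n := by exact_mod_cast hn
  have hn0 : (0 : ℝ) < n := by linarith
  have hb : (0 : ℝ) < 1 + 2 * β := by linarith
  -- At this index the prior variance `x ^ (-1 - 2β)` equals `1 / n`. Below it `s_i ≤ σ² / n` is
  -- used, above it `s_i ≤ l_i`; rounding up costs at most a factor `2`, as `x ≥ 1`.
  set x := (n : ℝ) ^ (1 / (1 + 2 * β)) with hx
  have hx1 : 1 ≤ x := Real.one_le_rpow hn' (by positivity)
  set N := ⌈x⌉₊ with hN
  have hxN : x ≤ N := Nat.le_ceil x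
  have hN1 : 1 ≤ N := Nat.one_le_ceil_iff.2 (by linarith)
  have hNx : (N : ℝ) ≤ 2 * x := by
    have := Nat.ceil_lt_add_one (show 0 ≤ x by linarith)
    linarith
  have hsq : ((n : ℝ) ^ (-(β / (1 + 2 * β)))) ^ 2 = (n : ℝ) ^ (-(2 * β / (1 + 2 * β))) := by
    rw [← Real.rpow_mul_natCast hn0.le]
    congr 1
    push_cast
    ring
  have hs : Summable fun i => (postVar β σ n i : ℝ) :=
    NNReal.summable_coe.2 (summable_postVar hβ σ n)
  have htail : ∑' j, (postVar β σ n (j + N) : ℝ) ≤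
      1 / (2 * β) * (n : ℝ) ^ (-(2 * β / (1 + 2 * β))) := by
    refine ((summable_nat_add_iff N).2 hs).tsum_le_of_sum_range_le fun a => ?_
    calc ∑ j ∈ Finset.range a, (postVar β σ n (j + N) : ℝ)
        ≤ ∑ j ∈ Finset.range a, ((N : ℝ) + (j + 1 : ℕ)) ^ (-1 - 2 * β) := by
          refine Finset.sum_le_sum fun j _ => (postVar_le_priorVar _ _ _ _).trans ?_
          rw [coe_priorVar]
          refine le_of_eq ?_
          congr 1
          push_cast
          ring
      _ ≤ (N : ℝ) ^ (-(2 * β)) / (2 * β) := sum_range_rpow_le hβ hN1 a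
      _ ≤ x ^ (-(2 * β)) / (2 * β) := by
          have := Real.rpow_le_rpow_of_nonpos (by linarith) hxN (show -(2 * β) ≤ 0 by linarith)
          gcongr
      _ = _ := by
          rw [hx, ← Real.rpow_mul hn0.le, div_eq_mul_inv, mul_comm, one_div (2 * β)]
          congr 2
          field_simp
  have hhead : ∑ i ∈ Finset.range N, (postVar β σ n i : ℝ) ≤
      2 * σ ^ 2 * (n : ℝ) ^ (-(2 * β / (1 + 2 * β))) := by
    calc ∑ i ∈ Finset.range N, (postVar β σ n i : ℝ)
        ≤ ∑ _i ∈ Finset.range N, σ ^ 2 / n :=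
          Finset.sum_le_sum fun i _ => postVar_le_div hσ β hn i
      _ = N * (σ ^ 2 / n) := by simp
      _ ≤ (2 * x) * (σ ^ 2 / n) := by gcongr
      _ = 2 * σ ^ 2 * (x * (n : ℝ) ^ (-1 : ℝ)) := by
          rw [Real.rpow_neg_one]; ring
      _ = _ := by
          rw [hx, ← Real.rpow_add hn0]
          congr 2
          field_simp
          ring
  rw [← hs.sum_add_tsum_nat_add N, hsq, add_mul]
  exact add_le_add hhead htail

/-! ### The law of the data -/

lemma dataLaw_eq (σ : ℝ) (n m : ℕ) (θ : Ell2) : dataLaw σ n m θ =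
    Measure.pi fun _ : Fin m => seqGaussian θ fun _ => Real.toNNReal (σ ^ 2 * m / n) := rfl

instance (σ : ℝ) (n m : ℕ) (θ : Ell2) : IsProbabilityMeasure (dataLaw σ n m θ) := by
  rw [dataLaw_eq]; infer_instance

lemma hasLaw_dataLaw (σ : ℝ) (n m : ℕ) (θ : Ell2) (j : Fin m) (i : ℕ) :
    HasLaw (fun Y : Fin m → ℕ → ℝ => Y j i)
      (gaussianReal (θ i) (Real.toNNReal (σ ^ 2 * m / n))) (dataLaw σ n m θ) := by
  refine ⟨((measurable_pi_apply i).comp (measurable_pi_apply j)).aemeasurable, ?_⟩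
  have h : (dataLaw σ n m θ).map (fun Y => Y j) =
      seqGaussian θ fun _ => Real.toNNReal (σ ^ 2 * m / n) := by
    rw [dataLaw_eq]
    exact (measurePreserving_eval (fun _ : Fin m =>
      seqGaussian θ fun _ => Real.toNNReal (σ ^ 2 * m / n)) j).map_eq
  rw [← seqGaussian_map_eval θ (fun _ => Real.toNNReal (σ ^ 2 * m / n)) i, ← h,
    Measure.map_map (by fun_prop) (by fun_prop)]
  rfl

lemma iIndepFun_dataLaw (σ : ℝ) (n m : ℕ) (θ : Ell2) (i : ℕ) :
    iIndepFun (fun (j : Fin m) (Y : Fin m → ℕ → ℝ) => Y j i) (dataLaw σ n m θ) := by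
  rw [dataLaw_eq, ← Measure.infinitePi_eq_pi]
  exact iIndepFun_infinitePi (X := fun (_ : Fin m) (y : ℕ → ℝ) => y i) fun _ => by fun_prop

/-- The mean squared error of a shrunken average of the observations of one coordinate. -/
lemma lintegral_shrunken_average_sub_sq (σ : ℝ) {n m : ℕ} (hm : 1 ≤ m) (θ : Ell2)
    (i : ℕ) (a : ℝ) :
    ∫⁻ Y, ENNReal.ofReal ((a * ((m : ℝ)⁻¹ * ∑ j, Y j i) - θ i) ^ 2) ∂dataLaw σ n m θ =
      ENNReal.ofReal (a ^ 2 * (σ ^ 2 / n) + ((1 - a) * θ i) ^ 2) := by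
  have hm' : (m : ℝ) ≠ 0 := by positivity
  have hlaw := fun j => hasLaw_dataLaw σ n m θ j i
  have hL : ∀ j, MemLp (fun Y : Fin m → ℕ → ℝ => Y j i) 2 (dataLaw σ n m θ) := fun j => by
    have h := memLp_id_gaussianReal' (μ := θ i) (v := Real.toNNReal (σ ^ 2 * m / n)) 2 (by simp)
    rw [← (hlaw j).map_eq] at h
    exact (memLp_map_measure_iff aestronglyMeasurable_id (hlaw j).aemeasurable).1 h
  have hsumL : MemLp (fun Y : Fin m → ℕ → ℝ => ∑ j, Y j i) 2 (dataLaw σ n m θ) :=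
    memLp_finsetSum _ fun j _ => hL j
  have hXL : MemLp (fun Y : Fin m → ℕ → ℝ => a * ((m : ℝ)⁻¹ * ∑ j, Y j i)) 2
      (dataLaw σ n m θ) := (hsumL.const_mul _).const_mul a
  have hmean : ∫ Y, (a * ((m : ℝ)⁻¹ * ∑ j, Y j i)) ∂dataLaw σ n m θ = a * θ i := by
    rw [integral_const_mul, integral_const_mul,
      integral_finsetSum _ fun j _ => (hL j).integrable (by simp)]
    simp_rw [fun j => (hlaw j).integral_eq, integral_id_gaussianReal]
    simp [hm']
  have hvar : Var[fun Y : Fin m → ℕ → ℝ => a * ((m : ℝ)⁻¹ * ∑ j, Y j i); dataLaw σ n m θ] =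
      a ^ 2 * (σ ^ 2 / n) := by
    rw [variance_const_mul, variance_const_mul]
    have h1 := IndepFun.variance_sum (s := Finset.univ) (fun j _ => hL j)
      fun j _ k _ hjk => (iIndepFun_dataLaw σ n m θ i).indepFun hjk
    have h2 : (∑ j, fun Y : Fin m → ℕ → ℝ => Y j i) = fun Y => ∑ j, Y j i := by
      ext Y; simp
    rw [h2] at h1
    rw [h1]
    simp_rw [fun j => (hlaw j).variance_eq, variance_id_gaussianReal]
    rw [Real.coe_toNNReal _ (by positivity)]
    simp only [Finset.sum_const, Finset.card_univ, Fintype.card_fin, nsmul_eq_mul]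
    field_simp
  have hXL' : MemLp (fun Y : Fin m → ℕ → ℝ => a * ((m : ℝ)⁻¹ * ∑ j, Y j i) - θ i) 2
      (dataLaw σ n m θ) := hXL.sub (memLp_const _)
  rw [lintegral_ofReal_sq hXL', variance_sub_const hXL.aestronglyMeasurable,
    hvar, integral_sub (hXL.integrable (by simp)) (integrable_const _), hmean]
  simp
  congr 1
  ring

/-- The noise variance is the same in all coordinates, so it takes the summable prior variances as
weights to obtain a convergent series. This is the only condition on the data that the conjugacy
formula needs. -/
lemma ae_summable_dataLaw {β : ℝ} (hβ : 0 < β) (σ : ℝ) (n m : ℕ) (θ : Ell2) :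
    ∀ᵐ Y ∂dataLaw σ n m θ, ∀ j, Summable fun i => (priorVar β i : ℝ) * Y j i ^ 2 := by
  have hl := NNReal.summable_coe.2 (summable_priorVar hβ)
  refine ae_all_iff.2 fun j => ?_
  rw [dataLaw_eq]
  have h1 : ∀ i, (priorVar β i : ℝ) ≤ 1 := fun i => by
    rw [coe_priorVar]
    exact Real.rpow_le_one_of_one_le_of_nonpos (by simp) (by linarith)
  have h := ae_summable_weighted_seqGaussian (μ := θ) (w := fun i => priorVar β i)
    (s := fun _ => Real.toNNReal (σ ^ 2 * m / n)) (fun i => (priorVar β i).coe_nonneg)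
    ((summable_sq θ).of_nonneg_of_le (fun i => by positivity)
      fun i => mul_le_of_le_one_left (sq_nonneg _) (h1 i))
    (hl.mul_right _)
  exact (measurePreserving_eval (fun _ : Fin m =>
      seqGaussian θ fun _ => Real.toNNReal (σ ^ 2 * m / n)) j).quasiMeasurePreserving.ae h

/-! ### The global posterior -/

/-- The `i`-th coordinate of the mean of the global posterior. -/
def waspMean (β σ : ℝ) (n m : ℕ) (Y : Fin m → ℕ → ℝ) (i : ℕ) : ℝ :=
  shrinkage β σ n i * ((m : ℝ)⁻¹ * ∑ j, Y j i)

lemma measurable_waspMean (β σ : ℝ) (n m : ℕ) (i : ℕ) :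
    Measurable fun Y : Fin m → ℕ → ℝ => waspMean β σ n m Y i := by
  unfold waspMean; fun_prop

/-- The local posteriors are translates of one Gaussian measure, and their barycenter is the
translate by the average. -/
theorem exists_waspPosterior_eq {β σ : ℝ} (hβ : 0 < β) (hσ : 0 < σ) {n m : ℕ} (hm : 1 ≤ m)
    {Y : Fin m → ℕ → ℝ} (hY : ∀ j, Summable fun i => (priorVar β i : ℝ) * Y j i ^ 2) :
    ∃ v : Ell2, (∀ i, v i = waspMean β σ n m Y i) ∧
      (∃! μ, IsWassersteinBarycenter (fun j => localPosterior β σ n m (Y j)) μ) ∧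
      waspPosterior β σ n m Y = ell2Gaussian v (postVar β σ n) := by
  have hs := summable_postVar hβ σ n
  choose w hw using fun j => mem_range_toSeq (summable_shrinkage_mul_sq (hY j) σ n)
  have hG := hasFiniteSecondMoment_ell2Gaussian (μ := fun _ => 0) (by simp) hs
  have hG0 : ∫ θ, θ ∂ell2Gaussian (fun _ => 0) (postVar β σ n) = 0 :=
    posteriorMean_ell2Gaussian 0 hs
  have hloc : (fun j => localPosterior β σ n m (Y j)) =
      fun j => (ell2Gaussian (fun _ => 0) (postVar β σ n)).map fun θ => θ + w j := by
    ext1 j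
    rw [ell2Gaussian_map_add _ hs, localPosterior_eq hβ hσ hm (hY j), ← hw j]
    rfl
  have hiff : ∀ μ, IsWassersteinBarycenter (fun j => localPosterior β σ n m (Y j)) μ ↔
      μ = ell2Gaussian ((m : ℝ)⁻¹ • ∑ j, w j : Ell2) (postVar β σ n) := fun μ => by
    rw [hloc, isWassersteinBarycenter_map_add_iff hm hG hG0, ell2Gaussian_map_add _ hs]
  have hex : ∃! μ, IsWassersteinBarycenter (fun j => localPosterior β σ n m (Y j)) μ :=
    ⟨_, (hiff _).2 rfl, fun μ hμ => (hiff μ).1 hμ⟩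
  refine ⟨(m : ℝ)⁻¹ • ∑ j, w j, fun i => ?_, hex, ?_⟩
  · have h1 : ∀ j, w j i = shrinkage β σ n i * Y j i := fun j => congrFun (hw j) i
    have h2 : ((∑ j, w j : Ell2) : ℕ → ℝ) i = ∑ j, w j i := by
      rw [lp.coeFn_sum, Finset.sum_apply]
    rw [lp.coeFn_smul, Pi.smul_apply, h2, waspMean, smul_eq_mul]
    simp_rw [h1]
    rw [← Finset.mul_sum]
    ring
  · rw [waspPosterior, wassersteinBarycenter, dif_pos hex.exists]
    exact (hiff _).1 hex.exists.choose_spec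

/-- The squared distance between the mean of the global posterior and `θ`. -/
def sqError (β σ : ℝ) (n m : ℕ) (θ : Ell2) (Y : Fin m → ℕ → ℝ) : ℝ≥0∞ :=
  ∑' i, ENNReal.ofReal ((waspMean β σ n m Y i - θ i) ^ 2)

lemma measurable_sqError (β σ : ℝ) (n m : ℕ) (θ : Ell2) : Measurable (sqError β σ n m θ) :=
  Measurable.tsum fun i => (((measurable_waspMean β σ n m i).sub_const _).pow_const 2).ennreal_ofReal

lemma sq_le_of_mem_hyperRectangle {β M : ℝ} {θ : Ell2} (hθ : θ ∈ hyperRectangle β M) (i : ℕ) :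
    θ i ^ 2 ≤ M ^ 2 * priorVar β i := by
  have h := hθ i
  have hp : (0 : ℝ) < (i : ℝ) + 1 := by positivity
  rw [coe_priorVar, show -1 - 2 * β = -(1 + 2 * β) by ring, Real.rpow_neg hp.le,
    ← div_eq_mul_inv, le_div_iff₀ (by positivity)]
  linarith

/-- The risk of the posterior mean is bounded by a multiple of the posterior spread. -/
theorem lintegral_sqError_le {β σ M : ℝ} (hβ : 0 < β) (hσ : 0 < σ) {n m : ℕ} (hn : 1 ≤ n)
    (hm : 1 ≤ m) {θ : Ell2} (hθ : θ ∈ hyperRectangle β M) :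
    ∫⁻ Y, sqError β σ n m θ Y ∂dataLaw σ n m θ ≤
      ENNReal.ofReal ((1 + M ^ 2) * ∑' i, (postVar β σ n i : ℝ)) := by
  have hs := NNReal.summable_coe.2 (summable_postVar hβ σ n)
  have hn' : (0 : ℝ) < n := by exact_mod_cast hn
  unfold sqError
  rw [lintegral_tsum fun i => (((measurable_waspMean β σ n m i).sub_const _).pow_const
    2).ennreal_ofReal.aemeasurable, ← tsum_mul_left,
    ENNReal.ofReal_tsum_of_nonneg (fun i => by positivity) (hs.mul_left _)]
  refine ENNReal.tsum_le_tsum fun i => ?_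
  simp only [waspMean]
  rw [lintegral_shrunken_average_sub_sq σ hm]
  refine ENNReal.ofReal_le_ofReal ?_
  have ha0 := shrinkage_nonneg β σ n i
  have ha1 := shrinkage_le_one β σ n i
  have hvar : shrinkage β σ n i * (σ ^ 2 / n) = postVar β σ n i := by
    rw [shrinkage, coe_precision]
    field_simp
  have hθi := sq_le_of_mem_hyperRectangle hθ i
  -- Variance plus squared bias. One factor `a_i`, respectively `1 - a_i`, is bounded by one; the
  -- other turns `σ² / n`, respectively `l_i`, into `s_i`.
  calc shrinkage β σ n i ^ 2 * (σ ^ 2 / n) + ((1 - shrinkage β σ n i) * θ i) ^ 2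
      = shrinkage β σ n i * postVar β σ n i +
        (1 - shrinkage β σ n i) * ((1 - shrinkage β σ n i) * θ i ^ 2) := by
        rw [← hvar]; ring
    _ ≤ 1 * postVar β σ n i +
        1 * ((1 - shrinkage β σ n i) * (M ^ 2 * priorVar β i)) := by
        have h1 : 0 ≤ 1 - shrinkage β σ n i := by linarith
        gcongr
        linarith
    _ = (1 + M ^ 2) * postVar β σ n i := by
        rw [postVar_eq]; ring

/-- Well-definedness of the global posterior, almost surely. -/
theorem ae_waspPosterior {β σ : ℝ} (hβ : 0 < β) (hσ : 0 < σ) (n : ℕ) {m : ℕ} (hm : 1 ≤ m)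
    (θ : Ell2) : ∀ᵐ Y ∂dataLaw σ n m θ, ∃ v : Ell2, ‖v - θ‖ₑ ^ 2 = sqError β σ n m θ Y ∧
      waspPosterior β σ n m Y = ell2Gaussian v (postVar β σ n) := by
  filter_upwards [ae_summable_dataLaw hβ σ n m θ] with Y hY
  obtain ⟨v, hv, -, hw⟩ := exists_waspPosterior_eq hβ hσ hm hY
  refine ⟨v, ?_, hw⟩
  rw [enorm_sq, sqError]
  exact tsum_congr fun i => by rw [← hv]; rfl

/-- Markov's inequality for the posterior. -/
lemma ell2Gaussian_dist_gt_le (v θ : Ell2) {s : ℕ → ℝ≥0} (hs : Summable s) {r : ℝ} (hr : 0 < r) :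
    ell2Gaussian v s {θ' | r < ‖θ' - θ‖} ≤
      (‖v - θ‖ₑ ^ 2 + ENNReal.ofReal (∑' i, (s i : ℝ))) / ENNReal.ofReal (r ^ 2) := by
  have hr2 : ENNReal.ofReal (r ^ 2) ≠ 0 := by simpa using hr.ne'
  have hsub : {θ' : Ell2 | r < ‖θ' - θ‖} ⊆ {θ' | ENNReal.ofReal (r ^ 2) ≤ ‖θ' - θ‖ₑ ^ 2} := by
    intro θ' h
    have h' : r < ‖θ' - θ‖ := h
    change ENNReal.ofReal (r ^ 2) ≤ ‖θ' - θ‖ₑ ^ 2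
    rw [← ofReal_norm, ENNReal.ofReal_pow hr.le]
    gcongr
  refine (measure_mono hsub).trans
    ((meas_ge_le_lintegral_div (by fun_prop) hr2 ENNReal.ofReal_ne_top).trans_eq ?_)
  rw [lintegral_enorm_sub_sq_ell2Gaussian (summable_sq v) hs, ENNReal.tsum_add, enorm_sq,
    ENNReal.ofReal_tsum_of_nonneg (fun i => (s i).coe_nonneg) (NNReal.summable_coe.2 hs)]
  simp

/-- Markov's inequality under the posterior, then the risk bound under the data. The result depends
on neither `n`, `m` nor `θ`, which gives the uniformity. -/
theorem lintegral_waspPosterior_le {β σ M : ℝ} (hβ : 0 < β) (hσ : 0 < σ) {n m : ℕ} (hn : 1 ≤ n)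
    (hm : 1 ≤ m) {θ : Ell2} (hθ : θ ∈ hyperRectangle β M) {K : ℝ} (hK : 0 < K) :
    ∫⁻ Y, waspPosterior β σ n m Y
      {θ' | K * (n : ℝ) ^ (-(β / (1 + 2 * β))) < ‖θ' - θ‖} ∂dataLaw σ n m θ ≤
      ENNReal.ofReal ((2 + M ^ 2) * (2 * σ ^ 2 + 1 / (2 * β)) / K ^ 2) := by
  have hn' : (0 : ℝ) < n := by exact_mod_cast hn
  set e := (n : ℝ) ^ (-(β / (1 + 2 * β))) with he
  have he0 : 0 < e := by positivity
  set T := ∑' i, (postVar β σ n i : ℝ) with hT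
  have hT0 : 0 ≤ T := tsum_nonneg fun i => (postVar β σ n i).coe_nonneg
  have hTe : T ≤ (2 * σ ^ 2 + 1 / (2 * β)) * e ^ 2 := tsum_postVar_le hβ hσ hn
  calc _ ≤ ∫⁻ Y, (sqError β σ n m θ Y + ENNReal.ofReal T) / ENNReal.ofReal ((K * e) ^ 2)
        ∂dataLaw σ n m θ := by
        -- The posterior mass need not be known to be measurable in `Y`: only the majorant, built
        -- from `sqError`, has to be.
        refine lintegral_mono_ae ?_
        filter_upwards [ae_waspPosterior hβ hσ n hm θ] with Y ⟨v, hv, hw⟩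
        rw [hw, ← hv]
        exact ell2Gaussian_dist_gt_le v θ (summable_postVar hβ σ n) (by positivity)
    _ ≤ (ENNReal.ofReal ((1 + M ^ 2) * T) + ENNReal.ofReal T) / ENNReal.ofReal ((K * e) ^ 2) := by
        simp_rw [div_eq_mul_inv]
        rw [lintegral_mul_const _ ((measurable_sqError β σ n m θ).add_const _),
          lintegral_add_left (measurable_sqError β σ n m θ)]
        gcongr
        · exact lintegral_sqError_le hβ hσ hn hm hθ
        · simp
    _ = ENNReal.ofReal ((2 + M ^ 2) * T / (K * e) ^ 2) := by
        rw [← ENNReal.ofReal_add (by positivity) hT0, ← ENNReal.ofReal_div_of_pos (by positivity)]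
        congr 2; ring
    _ ≤ _ := by
        refine ENNReal.ofReal_le_ofReal ?_
        rw [div_le_div_iff₀ (by positivity) (by positivity)]
        have := mul_le_mul_of_nonneg_left hTe (show 0 ≤ (2 + M ^ 2) * K ^ 2 by positivity)
        linarith

/-- Non-coverage forces the squared error of the mean above `L²` times the squared credible radius,
hence above a constant times `T`. Its expectation is at most `(1 + M²) T`, so `T` cancels in
Markov's inequality. -/
theorem dataLaw_notMem_credibleBall_le {β σ M γ L : ℝ} (hβ : 0 < β) (hσ : 0 < σ) {n m : ℕ}
    (hn : 1 ≤ n) (hm : 1 ≤ m) {θ : Ell2} (hθ : θ ∈ hyperRectangle β M)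
    (hγ : γ ∈ Set.Ioo (0 : ℝ) 1) (hL : 0 < L) :
    dataLaw σ n m θ {Y | θ ∉ credibleBall (waspPosterior β σ n m Y) γ L} ≤
      ENNReal.ofReal ((1 + M ^ 2) / (L ^ 2 * ((1 - γ) / 8) ^ 2)) := by
  have hγ' : 0 < 1 - γ := sub_pos.2 hγ.2
  have hs := summable_postVar hβ σ n
  have hpos : ∀ i, 0 < postVar β σ n i := fun i => tiltVar_pos (priorVar_pos β i)
  set T := ∑' i, (postVar β σ n i : ℝ) with hT
  have hT0 : 0 < T :=
    (NNReal.summable_coe.2 hs).tsum_pos (fun i => (postVar β σ n i).coe_nonneg) 0 (hpos 0)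
  set R := L ^ 2 * (((1 - γ) / 8) ^ 2 * T) with hR
  have hR0 : 0 < R := by positivity
  calc _ ≤ dataLaw σ n m θ {Y | ENNReal.ofReal R ≤ sqError β σ n m θ Y} := by
        refine measure_mono_ae ?_
        filter_upwards [ae_waspPosterior hβ hσ n hm θ] with Y ⟨v, hv, hw⟩ hY
        have hr := credibleRadius_sq_gt v hs hpos hγ
        have hr0 := (isCredibleRadius_credibleRadius
          (existsUnique_isCredibleRadius v hs (hpos 0) hγ)).1
        have hY' : θ ∉ credibleBall (waspPosterior β σ n m Y) γ L := hY
        rw [hw, credibleBall, Set.mem_ofPred_eq, posteriorMean_ell2Gaussian v hs, not_le,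
          norm_sub_rev] at hY'
        change ENNReal.ofReal R ≤ sqError β σ n m θ Y
        rw [← hv, ← ofReal_norm, ← ENNReal.ofReal_pow (norm_nonneg _)]
        refine ENNReal.ofReal_le_ofReal ?_
        have h1 := pow_le_pow_left₀ (mul_nonneg hL.le hr0) hY'.le 2
        rw [mul_pow] at h1
        exact (mul_le_mul_of_nonneg_left hr.le (sq_nonneg L)).trans h1
    _ ≤ (∫⁻ Y, sqError β σ n m θ Y ∂dataLaw σ n m θ) / ENNReal.ofReal R :=
        meas_ge_le_lintegral_div (measurable_sqError β σ n m θ).aemeasurable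
          (by simpa using hR0) ENNReal.ofReal_ne_top
    _ ≤ ENNReal.ofReal ((1 + M ^ 2) * T) / ENNReal.ofReal R := by
        gcongr
        exact lintegral_sqError_le hβ hσ hn hm hθ
    _ = _ := by
        rw [← ENNReal.ofReal_div_of_pos hR0]
        congr 1
        rw [hR]
        field_simp

end

/-! ### Well-definedness, contraction and coverage -/

theorem mainTheorem1 (σ β M : ℝ) (hσ : 0 < σ) (hβ : 0 < β) (hM : 0 < M) :
    -- the objects of the method are well defined, for almost all data
    (∀ n m : ℕ, 1 ≤ n → 1 ≤ m → ∀ θ₀ : Ell2, ∀ᵐ Y ∂(dataLaw σ n m θ₀),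
      (∀ j, HasFiniteSecondMoment (localPosterior β σ n m (Y j))) ∧
      (∃! μ, IsWassersteinBarycenter (fun j => localPosterior β σ n m (Y j)) μ) ∧
      (∀ γ ∈ Set.Ioo (0 : ℝ) 1, ∃! r, IsCredibleRadius (waspPosterior β σ n m Y) γ r)) ∧
    -- contraction at the rate `n ^ (-β / (1 + 2 β))`, uniformly over the hyperrectangle
    (∀ m : ℕ → ℕ, (∀ n, 1 ≤ m n) → ∀ K : ℕ → ℝ, Tendsto K atTop atTop →
      Tendsto (fun n : ℕ => ⨆ θ₀ ∈ hyperRectangle β M,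
        ∫⁻ Y, waspPosterior β σ n (m n) Y
          {θ | K n * (n : ℝ) ^ (-(β / (1 + 2 * β))) < ‖θ - θ₀‖} ∂(dataLaw σ n (m n) θ₀))
        atTop (𝓝 0)) ∧
    -- coverage of the blown-up credible balls, uniformly over the hyperrectangle
    (∀ γ ∈ Set.Ioo (0 : ℝ) 1, ∃ L₀ : ℝ, 0 < L₀ ∧ ∀ L : ℝ, L₀ ≤ L →
      ∀ n m : ℕ, 1 ≤ n → 1 ≤ m →
        (⨆ θ₀ ∈ hyperRectangle β M,
          dataLaw σ n m θ₀ {Y | θ₀ ∉ credibleBall (waspPosterior β σ n m Y) γ L})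
            ≤ ENNReal.ofReal γ) := by
  refine ⟨fun n m _ hm θ₀ => ?_, fun m hm K hK => ?_, fun γ hγ => ?_⟩
  · filter_upwards [ae_summable_dataLaw hβ σ n m θ₀] with Y hY
    obtain ⟨v, -, hex, hw⟩ := exists_waspPosterior_eq hβ hσ hm hY
    have hs := summable_postVar hβ σ n
    refine ⟨fun j => ?_, hex, fun γ hγ => ?_⟩
    · rw [localPosterior_eq hβ hσ hm (hY j)]
      exact hasFiniteSecondMoment_ell2Gaussian (summable_shrinkage_mul_sq (hY j) σ n) hs
    · rw [hw]
      exact existsUnique_isCredibleRadius v hs (tiltVar_pos (priorVar_pos β 0)) hγ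
  · set C := (2 + M ^ 2) * (2 * σ ^ 2 + 1 / (2 * β))
    have hlim : Tendsto (fun n => ENNReal.ofReal (C / K n ^ 2)) atTop (𝓝 0) := by
      have h1 : Tendsto (fun n => C / K n ^ 2) atTop (𝓝 0) :=
        ((tendsto_pow_atTop two_ne_zero).comp hK).const_div_atTop C
      simpa using ENNReal.tendsto_ofReal h1
    refine tendsto_of_tendsto_of_tendsto_of_le_of_le' tendsto_const_nhds hlim
      (Eventually.of_forall fun _ => zero_le) ?_
    -- The bound needs `n ≥ 1` and a positive radius, which hold only eventually.
    filter_upwards [eventually_ge_atTop 1, hK.eventually_gt_atTop 0] with n hn hKn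
    exact iSup₂_le fun θ₀ hθ₀ => lintegral_waspPosterior_le hβ hσ hn (hm n) hθ₀ hKn
  · have hγ' : 0 < 1 - γ := sub_pos.2 hγ.2
    have hγ0 : 0 < γ := hγ.1
    -- The value of `L²` at which the bound on the non-coverage probability equals `γ`.
    set B := (1 + M ^ 2) / (γ * ((1 - γ) / 8) ^ 2) with hB
    have hB0 : 0 < B := by positivity
    refine ⟨√B, Real.sqrt_pos.2 hB0, fun L hL n m hn hm => iSup₂_le fun θ₀ hθ₀ => ?_⟩
    have hL0 : 0 < L := (Real.sqrt_pos.2 hB0).trans_le hL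
    refine (dataLaw_notMem_credibleBall_le hβ hσ hn hm hθ₀ hγ hL0).trans
      (ENNReal.ofReal_le_ofReal ?_)
    have hL2 : B ≤ L ^ 2 := (Real.sqrt_le_left hL0.le).1 hL
    rw [hB, div_le_iff₀ (by positivity)] at hL2
    rw [div_le_iff₀ (by positivity)]
    linarith
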